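/- Let $\mathcal H\neq 0$ be a complex Hilbert space and let $B\subseteq B(\mathcal H)$ be a norm-closed $*$-subalgebra containing the identity operator. Let $\mathcal A_B$ be the $*$-algebra generated by $B$ and one additional unitary $u$ with no other relations, with the norm $\|a\|=\sup_\pi\|\pi(a)\|$, the supremum over all unital $*$-homomorphisms $\pi$ of $\mathcal A_B$ into $C^*$-algebras. An operator-valued state on $\mathcal A_B$ is a linear map $\phi:\mathcal A_B\to B(\mathcal H)$ with $\phi(1)=1$ such that, for all $a_1,\dots,a_n,b\in\mathcal A_B$ and $h_1,\dots,h_n\in\mathcal H$, $$\sum_{i,j}\langle \phi(a_j^*a_i)h_i,h_j\rangle\ge 0\quad\text{and}\quad \sum_{i,j}\langle \phi(a_j^*(\|b^*b\|-b^*b)a_i)h_i,h_j\rangle\ge 0 .$$ Let $E_{\mathcal A_B}^B$ be the set of conditional expectations $\mathcal A_B\to B$, that is, of those operator-valued states $\phi$ with $\phi(\mathcal A_B)\subseteq B$ and $\phi(b_1mb_2)=b_1\phi(m)b_2$ for all $b_1,b_2\in B$, $m\in\mathcal A_B$. For an operator-valued state $\phi$, let $\mathcal H_\phi$ be the Hilbert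 space obtained from $\mathcal A_B\otimes_{\mathrm{alg}}\mathcal H$ by separation and completion for the form $\langle a_1\otimes h_1,a_2\otimes h_2\rangle=\langle\phi(a_2^*a_1)h_1,h_2\rangle$, let $\pi_\phi$ be the representation of $\mathcal A_B$ on $\mathcal H_\phi$ by left multiplication, let $\mathcal H\hookrightarrow\mathcal H_\phi$ by $h\mapsto 1\otimes h$, and let $R_\phi:B(\mathcal H_\phi)\to B(\mathcal H)$ be the compression. Let $\mathrm{Ball}(B)=\bigcup_{n\ge1}\{X\in M_n(B):\|X\|<1\}$. The Herglotz function of $\phi$ is the map sending $X\in \mathrm{Ball}(B)\cap M_n(B)$ to the following element of $M_n(B(\mathcal H))$: $$g_\phi(X)=(R_\phi\otimes 1_n)\Big[\big(I+(\pi_\phi(u)\otimes I_n)(\pi_\phi\otimes 1_n)(X)\big)\big(I-(\pi_\phi(u)\otimes I_n)(\pi_\phi\otimes 1_n)(X)\big)^{-1}\Big].$$ A regular Herglotz function is a graded map $g$ on $\mathrm{Ball}(B)$ (so $g(X)\in M_n(B(\mathcal H))$ for $X\in M_n(B)$) such that $\Gamma g(X)=g(Y)\Gamma$ whenever $\Gamma$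 is a rectangular scalar matrix with $\Gamma X=Y\Gamma$, $\operatorname{Re} g(X)\ge0$ for all $X$, and $g(0)=I$. It is representable if for some Hilbert space $\widehat{\mathcal H}\supseteq\mathcal H$, unital $*$-representation $\alpha:B\to B(\widehat{\mathcal H})$ and unitary $U\in B(\widehat{\mathcal H})$ it is given by the same formula with $U$, $\alpha$ and the compression $B(\widehat{\mathcal H})\to B(\mathcal H)$ in place of $\pi_\phi(u)$, $\pi_\phi|_B$ and $R_\phi$. The pointwise weak operator topology on graded maps is the coarsest one for which all functions $g\mapsto\langle g(X)\xi,\eta\rangle$ ($X\in\mathrm{Ball}(B)\cap M_n(B)$, $\xi,\eta\in\mathcal H^n$) are continuous. Then: 1. $\phi\mapsto g_\phi$ maps $E_{\mathcal A_B}^B$ into the set of representable regular Herglotz functions. 2. If $B$ is not one-dimensional, then the map $\phi\mapsto g_\phi$ is not injective on $E_{\mathcal A_B}^B$. 3. If $B$ is closed in the weak operator topology, then $\{g_\phi:\phi\in E_{\mathcal A_B}^B\}$ is compact, and hence closed, in the pointwise weak operator topology. -/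

import Mathlib

open scoped InnerProductSpace ComplexOrder TensorProduct

/-- Generators of the unital algebra obtained from `B` by adjoining a unitary: the elements of `B`,
the new unitary `u` and its adjoint `u*`. -/
inductive UnitaryGen (B : Type*) : Type _
  | of (b : B) : UnitaryGen B
  | u : UnitaryGen B
  | uStar : UnitaryGen B

section Algebra

variable (B : Type*) [Ring B] [Algebra ℂ B]

/-- The relations: the unital algebra structure of `B`, and `u u* = u* u = 1`. -/
inductive UnitaryRel : FreeAlgebra ℂ (UnitaryGen B) → FreeAlgebra ℂ (UnitaryGen B) → Prop
  | add (b c : B) : UnitaryRel (FreeAlgebra.ι ℂ (.of (b + c)))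
      (FreeAlgebra.ι ℂ (.of b) + FreeAlgebra.ι ℂ (.of c))
  | mul (b c : B) : UnitaryRel (FreeAlgebra.ι ℂ (.of (b * c)))
      (FreeAlgebra.ι ℂ (.of b) * FreeAlgebra.ι ℂ (.of c))
  | scalar (r : ℂ) : UnitaryRel (FreeAlgebra.ι ℂ (.of (algebraMap ℂ B r)))
      (algebraMap ℂ (FreeAlgebra ℂ (UnitaryGen B)) r)
  | u_mul_uStar : UnitaryRel (FreeAlgebra.ι ℂ .u * FreeAlgebra.ι ℂ .uStar) 1
  | uStar_mul_u : UnitaryRel (FreeAlgebra.ι ℂ .uStar * FreeAlgebra.ι ℂ .u) 1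

/-- The formal `*`-algebra `𝒜_B` generated by the unital `*`-algebra `B` and one additional unitary
`u`, with no other relations. -/
def AdjoinUnitary : Type _ := RingQuot (UnitaryRel B)

namespace AdjoinUnitary

noncomputable instance : Ring (AdjoinUnitary B) := inferInstanceAs (Ring (RingQuot (UnitaryRel B)))

noncomputable instance : Algebra ℂ (AdjoinUnitary B) :=
  inferInstanceAs (Algebra ℂ (RingQuot (UnitaryRel B)))

/-- The class of a generator. -/
noncomputable def gen (g : UnitaryGen B) : AdjoinUnitary B :=
  RingQuot.mkAlgHom ℂ (UnitaryRel B) (FreeAlgebra.ι ℂ g)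

/-- The adjoined unitary. -/
noncomputable def u : AdjoinUnitary B := gen B .u

variable {B}

lemma gen_add (b c : B) : gen B (.of (b + c)) = gen B (.of b) + gen B (.of c) := by
  have h := RingQuot.mkAlgHom_rel ℂ (UnitaryRel.add b c)
  rw [map_add] at h
  exact h

lemma gen_mul (b c : B) : gen B (.of (b * c)) = gen B (.of b) * gen B (.of c) := by
  have h := RingQuot.mkAlgHom_rel ℂ (UnitaryRel.mul b c)
  rw [map_mul] at h
  exact h

lemma gen_scalar (r : ℂ) :
    gen B (.of (algebraMap ℂ B r)) = algebraMap ℂ (AdjoinUnitary B) r := by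
  have h := RingQuot.mkAlgHom_rel ℂ (UnitaryRel.scalar (B := B) r)
  rw [AlgHom.commutes] at h
  exact h

lemma u_mul_uStar : gen B .u * gen B .uStar = 1 := by
  have h := RingQuot.mkAlgHom_rel ℂ (UnitaryRel.u_mul_uStar (B := B))
  rw [map_mul, map_one] at h
  exact h

lemma uStar_mul_u : gen B .uStar * gen B .u = 1 := by
  have h := RingQuot.mkAlgHom_rel ℂ (UnitaryRel.uStar_mul_u (B := B))
  rw [map_mul, map_one] at h
  exact h

/-- The canonical homomorphism `B → 𝒜_B`. -/
noncomputable def ofAlgHom : B →ₐ[ℂ] AdjoinUnitary B where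
  toFun b := gen B (.of b)
  map_one' := by simpa using gen_scalar (B := B) 1
  map_mul' := gen_mul
  map_zero' := by simpa using gen_scalar (B := B) 0
  map_add' := gen_add
  commutes' := gen_scalar

/-- Universal property: an algebra homomorphism out of `𝒜_B` is given by its values on the
generators, subject to the defining relations. -/
noncomputable def lift {R : Type*} [Ring R] [Algebra ℂ R] (f : B →ₐ[ℂ] R) (v w : R)
    (h₁ : v * w = 1) (h₂ : w * v = 1) : AdjoinUnitary B →ₐ[ℂ] R :=
  RingQuot.liftAlgHom ℂ ⟨FreeAlgebra.lift ℂ (fun g => match g with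
    | .of b => f b
    | .u => v
    | .uStar => w), by
      intro x y h
      induction h <;> simp [h₁, h₂]⟩

lemma lift_gen {R : Type*} [Ring R] [Algebra ℂ R] (f : B →ₐ[ℂ] R) (v w : R)
    (h₁ : v * w = 1) (h₂ : w * v = 1) (g : UnitaryGen B) :
    lift f v w h₁ h₂ (gen B g) = match g with
      | .of b => f b
      | .u => v
      | .uStar => w := by
  refine (RingQuot.liftAlgHom_mkAlgHom_apply ℂ _ _ _).trans ?_
  rw [FreeAlgebra.lift_ι_apply]

@[ext]
lemma algHom_ext {R : Type*} [Semiring R] [Algebra ℂ R] {f g : AdjoinUnitary B →ₐ[ℂ] R}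
    (h : ∀ x, f (gen B x) = g (gen B x)) : f = g :=
  RingQuot.ringQuot_ext' ℂ (f := f) (g := g) (w := FreeAlgebra.hom_ext (funext h))

end AdjoinUnitary

end Algebra

section ConjOp

/-- The opposite ring of a complex algebra, with the conjugate scalar multiplication. -/
def ConjOp (A : Type*) : Type _ := Aᵐᵒᵖ

variable (A : Type*) [Ring A] [Algebra ℂ A]

instance : Ring (ConjOp A) := inferInstanceAs (Ring Aᵐᵒᵖ)

noncomputable instance : Algebra ℂ (ConjOp A) :=
  RingHom.toAlgebra' ((algebraMap ℂ Aᵐᵒᵖ).comp (starRingEnd ℂ)) fun r x =>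
    Algebra.commutes (R := ℂ) (A := Aᵐᵒᵖ) (starRingEnd ℂ r) x

end ConjOp

namespace AdjoinUnitary

variable {B : Type*} [Ring B] [StarRing B] [Algebra ℂ B] [StarModule ℂ B]

/-- The involution as a homomorphism to the conjugate opposite algebra:
`b ↦ b*`, `u ↦ u*`, `u* ↦ u`. -/
noncomputable def starHom : AdjoinUnitary B →ₐ[ℂ] ConjOp (AdjoinUnitary B) :=
  lift (R := ConjOp (AdjoinUnitary B))
    { toFun := fun b => MulOpposite.op (ofAlgHom (star b))
      map_one' := by simp; rfl
      map_mul' := fun x y => by simp; rfl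
      map_zero' := by simp; rfl
      map_add' := fun x y => by simp; rfl
      commutes' := fun r => by
        rw [← algebraMap_star_comm, AlgHom.commutes]; rfl }
    (MulOpposite.op (gen B .uStar)) (MulOpposite.op (gen B .u))
    (congrArg MulOpposite.op u_mul_uStar) (congrArg MulOpposite.op uStar_mul_u)

noncomputable instance : Star (AdjoinUnitary B) :=
  ⟨fun a => MulOpposite.unop (starHom a)⟩

lemma star_def (a : AdjoinUnitary B) : star a = MulOpposite.unop (starHom a) := rfl

lemma star_of (b : B) : star (ofAlgHom b : AdjoinUnitary B) = ofAlgHom (star b) := by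
  rw [star_def]
  exact congrArg (MulOpposite.unop (α := AdjoinUnitary B)) (lift_gen (R := ConjOp (AdjoinUnitary B)) _ _ _ _ _ (.of b))

lemma star_u : star (u B) = gen B .uStar := by
  rw [star_def]
  exact congrArg (MulOpposite.unop (α := AdjoinUnitary B)) (lift_gen (R := ConjOp (AdjoinUnitary B)) _ _ _ _ _ .u)

lemma star_uStar : star (gen B .uStar) = u B := by
  rw [star_def]
  exact congrArg (MulOpposite.unop (α := AdjoinUnitary B)) (lift_gen (R := ConjOp (AdjoinUnitary B)) _ _ _ _ _ .uStar)

lemma star_add_aux (a b : AdjoinUnitary B) : star (a + b) = star a + star b := by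
  simp only [star_def, map_add]; rfl

lemma star_mul_aux (a b : AdjoinUnitary B) : star (a * b) = star b * star a := by
  simp only [star_def, map_mul]; rfl

lemma star_algebraMap_aux (r : ℂ) :
    star (algebraMap ℂ (AdjoinUnitary B) r) = algebraMap ℂ _ (star r) := by
  simp only [star_def, AlgHom.commutes]; rfl

noncomputable instance : StarRing (AdjoinUnitary B) where
  star_involutive := by
    let f : AdjoinUnitary B →ₐ[ℂ] AdjoinUnitary B :=
      { toFun := fun a => star (star a)
        map_one' := by
          rw [← map_one (algebraMap ℂ (AdjoinUnitary B)), star_algebraMap_aux, star_algebraMap_aux,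
            star_star]
        map_mul' := fun a b => by rw [star_mul_aux, star_mul_aux]
        map_zero' := by
          rw [← map_zero (algebraMap ℂ (AdjoinUnitary B)), star_algebraMap_aux, star_algebraMap_aux,
            star_star]
        map_add' := fun a b => by rw [star_add_aux, star_add_aux]
        commutes' := fun r => by rw [star_algebraMap_aux, star_algebraMap_aux, star_star] }
    have hf : f = AlgHom.id ℂ _ := by
      ext x
      change star (star (gen B x)) = gen B x
      cases x with
      | of b =>
        change star (star (ofAlgHom b)) = ofAlgHom b
        rw [star_of, star_of, star_star]
      | u =>
        change star (star (u B)) = u B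
        rw [star_u, star_uStar]
      | uStar => rw [star_uStar, star_u]
    exact fun a => DFunLike.congr_fun hf a
  star_mul := star_mul_aux
  star_add := star_add_aux

instance : StarModule ℂ (AdjoinUnitary B) where
  star_smul r a := by
    rw [Algebra.smul_def, star_mul_aux, star_algebraMap_aux, ← Algebra.commutes, ← Algebra.smul_def]

/-- The canonical `*`-homomorphism `B → 𝒜_B`. -/
noncomputable def of : B →⋆ₐ[ℂ] AdjoinUnitary B where
  toAlgHom := ofAlgHom
  map_star' b := (star_of b).symm

lemma u_mem_unitary : u B ∈ unitary (AdjoinUnitary B) := by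
  rw [Unitary.mem_iff, star_u]
  exact ⟨uStar_mul_u, u_mul_uStar⟩

end AdjoinUnitary

section States

universe u v

/-- The universal pre-`C*`-norm on `𝒜_B`: the supremum of the norms of `a` in all unital
`*`-homomorphisms from `𝒜_B` to `C*`-algebras. -/
noncomputable def AdjoinUnitary.universalNorm {B : Type u} [Ring B] [StarRing B] [Algebra ℂ B]
    [StarModule ℂ B] (a : AdjoinUnitary B) : ℝ :=
  sSup {r : ℝ | ∃ (M : Type u) (_ : CStarAlgebra M) (π : AdjoinUnitary B →⋆ₐ[ℂ] M), r = ‖π a‖}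

/-- Operator-valued states on `𝒜_B`, with values in the bounded operators on `H`. Positivity of the
operator matrices `[φ(aⱼ* aᵢ)]` and `[φ(aⱼ* (‖b*b‖ - b*b) aᵢ)]` is positivity of the associated
quadratic forms on `Hⁿ`. -/
structure OperatorValuedState (B : Type u) [Ring B] [StarRing B] [Algebra ℂ B] [StarModule ℂ B]
    (H : Type v) [NormedAddCommGroup H] [InnerProductSpace ℂ H] where
  toLinearMap : AdjoinUnitary B →ₗ[ℂ] (H →L[ℂ] H)
  unital : toLinearMap 1 = 1
  completely_positive : ∀ (n : ℕ) (a : Fin n → AdjoinUnitary B) (h : Fin n → H),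
    0 ≤ ∑ i, ∑ j, ⟪h j, toLinearMap (star (a j) * a i) (h i)⟫_ℂ
  completely_bounded : ∀ (n : ℕ) (a : Fin n → AdjoinUnitary B) (b : AdjoinUnitary B)
    (h : Fin n → H),
    0 ≤ ∑ i, ∑ j, ⟪h j, toLinearMap (star (a j) *
      (algebraMap ℂ _ ((star b * b).universalNorm : ℂ) - star b * b) * a i) (h i)⟫_ℂ

namespace OperatorValuedState

variable {B : Type u} [Ring B] [StarRing B] [Algebra ℂ B] [StarModule ℂ B]
  {H : Type v} [NormedAddCommGroup H] [InnerProductSpace ℂ H]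

/-- The sesquilinear form on `𝒜_B ⊗ H` with
`(a₂ ⊗ h₂, a₁ ⊗ h₁) ↦ ⟪h₂, φ(a₂* a₁) h₁⟫`, conjugate linear in the first variable. -/
noncomputable def form (φ : OperatorValuedState B H) :
    AdjoinUnitary B ⊗[ℂ] H →ₗ⋆[ℂ] AdjoinUnitary B ⊗[ℂ] H →ₗ[ℂ] ℂ :=
  TensorProduct.lift <| LinearMap.mk₂'ₛₗ (starRingEnd ℂ) (starRingEnd ℂ)
    (fun a h => TensorProduct.lift <| LinearMap.mk₂' ℂ ℂ
      (fun b k => ⟪h, φ.toLinearMap (star a * b) k⟫_ℂ)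
      (fun b b' k => by simp [mul_add])
      (fun c b k => by simp)
      (fun b k k' => by simp)
      (fun c b k => by simp))
    (fun a a' h => by
      refine TensorProduct.ext' fun b k => ?_
      simp [add_mul])
    (fun c a h => by
      refine TensorProduct.ext' fun b k => ?_
      simp)
    (fun a h h' => by
      refine TensorProduct.ext' fun b k => ?_
      simp)
    (fun c a h => by
      refine TensorProduct.ext' fun b k => ?_
      simp [mul_comm])

@[simp]
lemma form_tmul (φ : OperatorValuedState B H) (a b : AdjoinUnitary B) (h k : H) :
    φ.form (a ⊗ₜ h) (b ⊗ₜ k) = ⟪h, φ.toLinearMap (star a * b) k⟫_ℂ := rfl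

lemma form_self_nonneg (φ : OperatorValuedState B H) (x : AdjoinUnitary B ⊗[ℂ] H) :
    0 ≤ φ.form x x := by
  obtain ⟨n, a, h, rfl⟩ := TensorProduct.exists_sum_tmul_eq x
  have := φ.completely_positive n a h
  simpa [map_sum, LinearMap.sum_apply] using this

lemma form_conj_symm (φ : OperatorValuedState B H) (x y : AdjoinUnitary B ⊗[ℂ] H) :
    starRingEnd ℂ (φ.form y x) = φ.form x y := by
  have h : ∀ z, (φ.form z z).im = 0 := fun z =>
    (Complex.nonneg_iff.mp (φ.form_self_nonneg z)).2.symm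
  have h1 := h (x + y)
  have h2 := h (x + Complex.I • y)
  simp only [map_add, LinearMap.add_apply, LinearMap.map_smulₛₗ, LinearMap.smul_apply,
    smul_eq_mul, Complex.add_im, Complex.mul_im, Complex.conj_I, Complex.neg_re, Complex.neg_im,
    Complex.I_re, Complex.I_im, Complex.mul_re, Complex.add_re, h x, h y, RingHom.id_apply]
    at h1 h2
  apply Complex.ext
  · simp only [Complex.conj_re]; linarith
  · simp only [Complex.conj_im]; linarith

/-- The space `𝒜_B ⊗ H`, to be equipped with the semi-inner product given by `φ`. -/
def PreGNS (_φ : OperatorValuedState B H) : Type _ := AdjoinUnitary B ⊗[ℂ] H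

noncomputable instance (φ : OperatorValuedState B H) : AddCommGroup φ.PreGNS :=
  inferInstanceAs (AddCommGroup (AdjoinUnitary B ⊗[ℂ] H))

noncomputable instance (φ : OperatorValuedState B H) : Module ℂ φ.PreGNS :=
  inferInstanceAs (Module ℂ (AdjoinUnitary B ⊗[ℂ] H))

/-- The identity map from `𝒜_B ⊗ H` to the semi-inner product space. -/
noncomputable def toPreGNS (φ : OperatorValuedState B H) : AdjoinUnitary B ⊗[ℂ] H ≃ₗ[ℂ] φ.PreGNS :=
  LinearEquiv.refl ℂ _

/-- The semi-inner product `⟪a₂ ⊗ h₂, a₁ ⊗ h₁⟫ = ⟪h₂, φ(a₂* a₁) h₁⟫`. -/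
noncomputable abbrev preGNSCore (φ : OperatorValuedState B H) :
    PreInnerProductSpace.Core ℂ φ.PreGNS where
  inner x y := φ.form (φ.toPreGNS.symm x) (φ.toPreGNS.symm y)
  conj_inner_symm _ _ := φ.form_conj_symm _ _
  re_inner_nonneg _ := (Complex.nonneg_iff.mp (φ.form_self_nonneg _)).1
  add_left x y z := by simp
  smul_left x y r := by simp

noncomputable instance (φ : OperatorValuedState B H) : SeminormedAddCommGroup φ.PreGNS :=
  InnerProductSpace.Core.toSeminormedAddCommGroup (c := φ.preGNSCore)

noncomputable instance (φ : OperatorValuedState B H) : InnerProductSpace ℂ φ.PreGNS :=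
  InnerProductSpace.ofCore φ.preGNSCore

lemma preGNS_inner_def (φ : OperatorValuedState B H) (x y : φ.PreGNS) :
    ⟪x, y⟫_ℂ = φ.form (φ.toPreGNS.symm x) (φ.toPreGNS.symm y) := rfl

/-- The Hilbert space `ℋ_φ`: the Hausdorff completion of `𝒜_B ⊗ H`. -/
abbrev GNS (φ : OperatorValuedState B H) : Type _ := UniformSpace.Completion φ.PreGNS

/-- Left multiplication `a' ⊗ h ↦ a a' ⊗ h`, as a linear map. -/
noncomputable def leftMulₗ (φ : OperatorValuedState B H) (a : AdjoinUnitary B) :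
    φ.PreGNS →ₗ[ℂ] φ.PreGNS :=
  φ.toPreGNS.toLinearMap ∘ₗ (LinearMap.mulLeft ℂ a).rTensor H ∘ₗ φ.toPreGNS.symm.toLinearMap

@[simp]
lemma leftMulₗ_tmul (φ : OperatorValuedState B H) (a b : AdjoinUnitary B) (h : H) :
    φ.leftMulₗ a (φ.toPreGNS (b ⊗ₜ h)) = φ.toPreGNS ((a * b) ⊗ₜ h) := by
  simp [leftMulₗ]

lemma preGNS_induction {φ : OperatorValuedState B H} {p : φ.PreGNS → Prop}
    (tmul : ∀ a h, p (φ.toPreGNS (a ⊗ₜ h))) (add : ∀ x y, p x → p y → p (x + y))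
    (x : φ.PreGNS) : p x := by
  change p (φ.toPreGNS (φ.toPreGNS.symm x))
  induction φ.toPreGNS.symm x using TensorProduct.induction_on with
  | zero => simpa using tmul 0 0
  | tmul a h => exact tmul a h
  | add y z hy hz => rw [map_add]; exact add _ _ hy hz

lemma leftMulₗ_inner (φ : OperatorValuedState B H) (a : AdjoinUnitary B) (x y : φ.PreGNS) :
    ⟪φ.leftMulₗ (star a) x, y⟫_ℂ = ⟪x, φ.leftMulₗ a y⟫_ℂ := by
  induction x using preGNS_induction with
  | add x x' hx hx' => simp only [map_add, inner_add_left, hx, hx']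
  | tmul b h =>
    induction y using preGNS_induction with
    | add y y' hy hy' => simp only [map_add, inner_add_right, hy, hy']
    | tmul c k => simp [preGNS_inner_def, mul_assoc]

lemma universalNorm_nonneg (a : AdjoinUnitary B) : 0 ≤ a.universalNorm := by
  refine Real.sSup_nonneg ?_
  rintro _ ⟨M, _, π, rfl⟩
  exact norm_nonneg _

lemma norm_leftMulₗ_le (φ : OperatorValuedState B H) (a : AdjoinUnitary B) (x : φ.PreGNS) :
    ‖φ.leftMulₗ a x‖ ≤ Real.sqrt ((star a * a).universalNorm) * ‖x‖ := by
  have key : 0 ≤ ((star a * a).universalNorm : ℂ) * ⟪x, x⟫_ℂ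
      - ⟪φ.leftMulₗ a x, φ.leftMulₗ a x⟫_ℂ := by
    obtain ⟨n, b, h, hx⟩ := TensorProduct.exists_sum_tmul_eq (φ.toPreGNS.symm x)
    have hx' : x = ∑ i, φ.toPreGNS (b i ⊗ₜ h i) := by
      rw [← map_sum, ← hx, LinearEquiv.apply_symm_apply]
    have := φ.completely_bounded n b a h
    rw [Finset.sum_comm] at this
    refine this.trans_eq ?_
    rw [hx']
    simp only [map_sum, sum_inner, inner_sum, leftMulₗ_tmul, Finset.mul_sum,
      ← Finset.sum_sub_distrib]
    rw [Finset.sum_comm]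
    refine Finset.sum_congr rfl fun i _ => Finset.sum_congr rfl fun j _ => ?_
    simp [preGNS_inner_def, mul_sub, sub_mul, mul_assoc,
      Algebra.algebraMap_eq_smul_one]
  have key' : ‖φ.leftMulₗ a x‖ ^ 2 ≤ (star a * a).universalNorm * ‖x‖ ^ 2 := by
    have h := (Complex.nonneg_iff.mp key).1
    rw [Complex.sub_re, Complex.re_ofReal_mul] at h
    rw [norm_sq_eq_re_inner (𝕜 := ℂ), norm_sq_eq_re_inner (𝕜 := ℂ) x]
    exact sub_nonneg.mp h
  refine (sq_le_sq₀ (norm_nonneg _) (by positivity)).mp ?_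
  rwa [mul_pow, Real.sq_sqrt (universalNorm_nonneg _)]

/-- Left multiplication by `a` as a bounded operator. -/
noncomputable def leftMul (φ : OperatorValuedState B H) (a : AdjoinUnitary B) :
    φ.PreGNS →L[ℂ] φ.PreGNS :=
  (φ.leftMulₗ a).mkContinuous (Real.sqrt ((star a * a).universalNorm)) (φ.norm_leftMulₗ_le a)

lemma leftMul_apply (φ : OperatorValuedState B H) (a : AdjoinUnitary B) (x : φ.PreGNS) :
    φ.leftMul a x = φ.leftMulₗ a x := rfl

@[simp]
lemma leftMul_tmul (φ : OperatorValuedState B H) (a b : AdjoinUnitary B) (h : H) :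
    φ.leftMul a (φ.toPreGNS (b ⊗ₜ h)) = φ.toPreGNS ((a * b) ⊗ₜ h) :=
  φ.leftMulₗ_tmul a b h

lemma completion_ext {φ : OperatorValuedState B H} {S T : φ.GNS →L[ℂ] φ.GNS}
    (h : ∀ a k, S (φ.toPreGNS (a ⊗ₜ k) : φ.PreGNS) = T (φ.toPreGNS (a ⊗ₜ k) : φ.PreGNS)) :
    S = T := by
  ext x
  induction x using UniformSpace.Completion.induction_on with
  | hp => exact isClosed_eq S.continuous T.continuous
  | ih x =>
    induction x using preGNS_induction with
    | tmul a k => exact h a k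
    | add x y hx hy => rw [UniformSpace.Completion.coe_add, map_add, map_add, hx, hy]

/-- The representation `π_φ` of `𝒜_B` on `ℋ_φ` by left multiplication. -/
noncomputable def rep (φ : OperatorValuedState B H) :
    AdjoinUnitary B →⋆ₐ[ℂ] (φ.GNS →L[ℂ] φ.GNS) where
  toFun a := (φ.leftMul a).completion
  map_one' := completion_ext fun b k => by simp
  map_mul' a a' := completion_ext fun b k => by simp [mul_assoc]
  map_zero' := completion_ext fun b k => by simp [UniformSpace.Completion.coe_zero]
  map_add' a a' := completion_ext fun b k => by
    simp [add_mul, TensorProduct.add_tmul, UniformSpace.Completion.coe_add]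
  commutes' r := completion_ext fun b k => by
    simp [Algebra.algebraMap_eq_smul_one, ← TensorProduct.smul_tmul',
      UniformSpace.Completion.coe_smul]
  map_star' a := by
    refine (ContinuousLinearMap.eq_adjoint_iff _ _).mpr fun x y => ?_
    induction x, y using UniformSpace.Completion.induction_on₂ with
    | hp => apply isClosed_eq <;> fun_prop
    | ih x y => simpa [leftMul_apply] using φ.leftMulₗ_inner a x y

/-- The isometric inclusion `h ↦ 1 ⊗ h` of `H` into `ℋ_φ`. -/
noncomputable def incl (φ : OperatorValuedState B H) : H →ₗᵢ[ℂ] φ.GNS :=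
  (UniformSpace.Completion.toComplₗᵢ (𝕜 := ℂ) (E := φ.PreGNS)).comp
    { toLinearMap := φ.toPreGNS.toLinearMap ∘ₗ TensorProduct.mk ℂ (AdjoinUnitary B) H 1
      norm_map' := fun h => by
        rw [@norm_eq_sqrt_re_inner ℂ, @norm_eq_sqrt_re_inner ℂ _ _ _ _ h, preGNS_inner_def]
        change √(RCLike.re (φ.form (1 ⊗ₜ h) (1 ⊗ₜ h))) = _
        simp only [form_tmul, star_one, mul_one, φ.unital, one_apply_eq_self] }

end OperatorValuedState

end States

section Herglotz

universe u

variable {H : Type u} [NormedAddCommGroup H] [InnerProductSpace ℂ H] [CompleteSpace H]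

/-- The noncommutative unit ball of a subalgebra `B` of `B(H)`: square matrices over `B`, of any
positive size, whose norm as a matrix over the `C*`-algebra `B(H)` is less than one. -/
structure FreeBall (B : StarSubalgebra ℂ (H →L[ℂ] H)) : Type u where
  size : ℕ+
  mat : CStarMatrix (Fin size) (Fin size) B
  norm_lt_one : ‖mat.map (fun b : B => (b : H →L[ℂ] H))‖ < 1

/-- Graded maps on the noncommutative unit ball of `B`: an `n × n` matrix over `B` is sent to an
`n × n` matrix over `B(H)`. -/
def GradedMap (B : StarSubalgebra ℂ (H →L[ℂ] H)) : Type u :=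
  ∀ X : FreeBall B, CStarMatrix (Fin X.size) (Fin X.size) (H →L[ℂ] H)

/-- The sesquilinear form `⟨T ξ, η⟩` of a matrix `T` over `B(H)`, acting on `Hⁿ`. -/
noncomputable def matrixForm {n : ℕ} (T : CStarMatrix (Fin n) (Fin n) (H →L[ℂ] H))
    (ξ η : Fin n → H) : ℂ :=
  ∑ i, ∑ j, ⟪η i, T i j (ξ j)⟫_ℂ

/-- The pointwise weak operator topology: the coarsest topology for which all functions
`g ↦ ⟨g(X) ξ, η⟩` are continuous. -/
noncomputable instance GradedMap.pointwiseWOT (B : StarSubalgebra ℂ (H →L[ℂ] H)) :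
    TopologicalSpace (GradedMap B) :=
  ⨅ (X : FreeBall B) (ξ : Fin X.size → H) (η : Fin X.size → H),
    TopologicalSpace.induced (fun g : GradedMap B => matrixForm (g X) ξ η) inferInstance

/-- A scalar matrix regarded as a matrix over a complex algebra. -/
def scalarMatrix {m n : ℕ} (R : Type*) [Ring R] [Algebra ℂ R] (Γ : Matrix (Fin m) (Fin n) ℂ) :
    CStarMatrix (Fin m) (Fin n) R :=
  CStarMatrix.ofMatrix (Γ.map (algebraMap ℂ R))

/-- Regular free Herglotz functions: graded maps which respect intertwining by scalar matrices,
have nonnegative real part, and take the value `I` at `0`. -/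
structure IsRegularHerglotz {B : StarSubalgebra ℂ (H →L[ℂ] H)} (g : GradedMap B) : Prop where
  intertwines : ∀ (X Y : FreeBall B) (Γ : Matrix (Fin Y.size) (Fin X.size) ℂ),
    scalarMatrix B Γ * X.mat = Y.mat * scalarMatrix B Γ →
      scalarMatrix (H →L[ℂ] H) Γ * g X = g Y * scalarMatrix (H →L[ℂ] H) Γ
  re_nonneg : ∀ (X : FreeBall B) (ξ : Fin X.size → H), 0 ≤ (matrixForm (g X) ξ ξ).re
  map_zero : ∀ X : FreeBall B, X.mat = 0 → g X = 1

/-- For a Hilbert space `K` containing `H` through `V`, a representation `α` of `B` on `K` and an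
operator `U` on `K`, the graded map
`X ↦ (R ⊗ 1ₙ)[(I + (U ⊗ Iₙ) (α ⊗ 1ₙ)(X)) (I - (U ⊗ Iₙ) (α ⊗ 1ₙ)(X))⁻¹]`,
where `R` is the compression of operators on `K` to `H`. -/
noncomputable def herglotzMap {B : StarSubalgebra ℂ (H →L[ℂ] H)} {K : Type*}
    [NormedAddCommGroup K] [InnerProductSpace ℂ K] [CompleteSpace K] (V : H →ₗᵢ[ℂ] K)
    (α : B →⋆ₐ[ℂ] (K →L[ℂ] K)) (U : K →L[ℂ] K) : GradedMap B := fun X =>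
  let T : CStarMatrix (Fin X.size) (Fin X.size) (K →L[ℂ] K) :=
    CStarMatrix.ofMatrix (Matrix.diagonal fun _ => U) * X.mat.map α
  ((1 + T) * Ring.inverse (1 - T)).map fun S =>
    ContinuousLinearMap.adjoint V.toContinuousLinearMap ∘L S ∘L V.toContinuousLinearMap

/-- The set of representable regular Herglotz functions on `B` with values in `B(H)`. -/
def representableHerglotz (B : StarSubalgebra ℂ (H →L[ℂ] H)) : Set (GradedMap B) :=
  {g | IsRegularHerglotz g ∧
    ∃ (K : Type u) (_ : NormedAddCommGroup K) (_ : InnerProductSpace ℂ K) (_ : CompleteSpace K)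
      (V : H →ₗᵢ[ℂ] K) (α : B →⋆ₐ[ℂ] (K →L[ℂ] K)) (U : unitary (K →L[ℂ] K)),
      g = herglotzMap V α (U : K →L[ℂ] K)}

/-- The Herglotz function `g_φ` of an operator-valued state `φ` on `𝒜_B`. -/
noncomputable def OperatorValuedState.herglotz {B : StarSubalgebra ℂ (H →L[ℂ] H)}
    (φ : OperatorValuedState B H) : GradedMap B :=
  herglotzMap φ.incl (φ.rep.comp AdjoinUnitary.of) (φ.rep (AdjoinUnitary.u B))

/-- The conditional expectations `𝒜_B → B`, viewed as operator-valued states: those with values in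
`B` which are `B`-bimodule maps. -/
def conditionalExpectations (B : StarSubalgebra ℂ (H →L[ℂ] H)) : Set (OperatorValuedState B H) :=
  {φ | (∀ m, φ.toLinearMap m ∈ B) ∧ ∀ (b₁ b₂ : B) (m : AdjoinUnitary B),
    φ.toLinearMap (AdjoinUnitary.of b₁ * m * AdjoinUnitary.of b₂) =
      (b₁ : H →L[ℂ] H) * φ.toLinearMap m * (b₂ : H →L[ℂ] H)}

end Herglotz

/-!
The argument rests on the Neumann series of the Herglotz function: with `M = (u ⊗ Iₙ) X`, regarded
as a matrix over `𝒜_B`, the matrix `g_φ(X)` is the sum over `k` of the result of applying `φ` to the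
entries of `(I + M) Mᵏ` (`OperatorValuedState.hasSum_herglotzTerm`). The series converges because
`*`-homomorphisms of `C*`-algebras, and hence their matrix amplifications, are contractive, so that
`‖π_φ(M)‖ ≤ ‖X‖ < 1`.

*Representability.* The GNS representation provides the required Hilbert space, and it remains to
see that the Cayley transform `F = (1 + T) (1 - T)⁻¹` of a strict contraction `T` satisfies
`F + F* = 2 W* (1 - T* T) W ≥ 0` with `W = (1 - T)⁻¹`, and respects intertwining relations
(`isRegularHerglotz_herglotzMap`).

*Failure of injectivity.* By the Neumann series `g_φ` only sees the moments `φ(u b₁ u b₂ ⋯ u bₖ)`.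
A `C*`-algebra that is not one-dimensional has a unital `*`-endomorphism `θ ≠ id`: an inner
automorphism if it is not commutative, and a character otherwise
(`CStarAlgebra.exists_starAlgHom_ne_id`). On `ℓ²(ℤ, H)` let `u` act as the bilateral shift and let
`b ∈ B` act as `b` in degree `0` and as `θ(b)`, respectively as `b`, in all other degrees.
Compression to degree `0` gives two conditional expectations all of whose moments as above vanish
for `k ≥ 1`, but which take different values on `u* b u` (`not_injOn_herglotz`).

*Compactness.* In the topology of pointwise weak operator convergence the space of all
operator-valued states is compact, by boundedness of the coefficients `⟪h, φ(a) k⟫`; when `B` is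
closed in the weak operator topology the conditional expectations form a closed subset
(`isCompact_conditionalExpectations`). The Neumann series converges uniformly in `φ`, so `φ ↦ g_φ`
is continuous (`OperatorValuedState.continuous_herglotz`), and its image is compact in a Hausdorff
space.
-/

/-! ### Matrices of operators and their quadratic forms -/

section MatrixForm

universe u

variable {H : Type u} [NormedAddCommGroup H] [InnerProductSpace ℂ H]

lemma matrixForm_add {n : ℕ} (S T : CStarMatrix (Fin n) (Fin n) (H →L[ℂ] H)) (ξ η : Fin n → H) :
    matrixForm (S + T) ξ η = matrixForm S ξ η + matrixForm T ξ η := by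
  simp [matrixForm, Finset.sum_add_distrib]

lemma eq_of_matrixForm_eq {n : ℕ} {S T : CStarMatrix (Fin n) (Fin n) (H →L[ℂ] H)}
    (h : ∀ ξ η, matrixForm S ξ η = matrixForm T ξ η) : S = T := by
  ext i j k
  refine ext_inner_left ℂ fun l => ?_
  have hS : ∀ S : CStarMatrix (Fin n) (Fin n) (H →L[ℂ] H),
      matrixForm S (Pi.single j k) (Pi.single i l) = ⟪l, S i j k⟫_ℂ := fun S => by
    rw [matrixForm, Finset.sum_eq_single i, Finset.sum_eq_single j]
    · simp
    · intro b _ hb; simp [hb]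
    · simp
    · intro b _ hb; simp [hb]
    · simp
  rw [← hS, ← hS, h]

variable [CompleteSpace H]
  {K : Type u} [NormedAddCommGroup K] [InnerProductSpace ℂ K] [CompleteSpace K]

/-- The compression `S ↦ V* S V` of operators on `K` to `H`, along an isometry `V : H → K`. -/
noncomputable def compression (V : H →ₗᵢ[ℂ] K) : (K →L[ℂ] K) →ₗ[ℂ] (H →L[ℂ] H) where
  toFun S := ContinuousLinearMap.adjoint V.toContinuousLinearMap ∘L S ∘L V.toContinuousLinearMap
  map_add' S T := by ext; simp
  map_smul' c S := by ext; simp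

lemma inner_compression (V : H →ₗᵢ[ℂ] K) (S : K →L[ℂ] K) (h k : H) :
    ⟪h, compression V S k⟫_ℂ = ⟪V h, S (V k)⟫_ℂ := by
  simp [compression, ContinuousLinearMap.adjoint_inner_right]

lemma compression_one (V : H →ₗᵢ[ℂ] K) : compression V 1 = 1 := by
  ext k
  refine ext_inner_left ℂ fun h => ?_
  simp [inner_compression]

lemma matrixForm_map_compression {n : ℕ} (V : H →ₗᵢ[ℂ] K)
    (S : CStarMatrix (Fin n) (Fin n) (K →L[ℂ] K)) (ξ η : Fin n → H) :
    matrixForm (S.map (compression V)) ξ η = matrixForm S (V ∘ ξ) (V ∘ η) := by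
  simp [matrixForm, inner_compression]

/-- The form `S ↦ ⟨S ξ, η⟩` as a linear functional on operator matrices. -/
noncomputable def matrixFormₗ {n : ℕ} (ξ η : Fin n → H) :
    CStarMatrix (Fin n) (Fin n) (H →L[ℂ] H) →ₗ[ℂ] ℂ where
  toFun S := matrixForm S ξ η
  map_add' S T := matrixForm_add S T ξ η
  map_smul' c S := by simp [matrixForm, Finset.mul_sum]

lemma norm_matrixForm_le {n : ℕ} (S : CStarMatrix (Fin n) (Fin n) (H →L[ℂ] H))
    (ξ η : Fin n → H) : ‖matrixForm S ξ η‖ ≤ (∑ i, ∑ j, ‖η i‖ * ‖ξ j‖) * ‖S‖ := by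
  simp only [matrixForm, Finset.sum_mul]
  refine (norm_sum_le _ _).trans (Finset.sum_le_sum fun i _ => ?_)
  refine (norm_sum_le _ _).trans (Finset.sum_le_sum fun j _ => ?_)
  calc ‖⟪η i, S i j (ξ j)⟫_ℂ‖ ≤ ‖η i‖ * (‖S i j‖ * ‖ξ j‖) :=
        (norm_inner_le_norm _ _).trans (by gcongr; exact (S i j).le_opNorm _)
    _ ≤ ‖η i‖ * (‖S‖ * ‖ξ j‖) := by gcongr; exact CStarMatrix.norm_entry_le_norm
    _ = ‖η i‖ * ‖ξ j‖ * ‖S‖ := by ring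

lemma continuous_matrixForm {n : ℕ} (ξ η : Fin n → H) :
    Continuous fun S : CStarMatrix (Fin n) (Fin n) (H →L[ℂ] H) => matrixForm S ξ η :=
  AddMonoidHomClass.continuous_of_bound (matrixFormₗ ξ η) _
    fun S => norm_matrixForm_le S ξ η

lemma matrixForm_star_self_re {n : ℕ} (S : CStarMatrix (Fin n) (Fin n) (H →L[ℂ] H))
    (ξ : Fin n → H) : (matrixForm (star S) ξ ξ).re = (matrixForm S ξ ξ).re := by
  have : matrixForm (star S) ξ ξ = starRingEnd ℂ (matrixForm S ξ ξ) := by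
    simp only [matrixForm, map_sum, inner_conj_symm]
    rw [Finset.sum_comm]
    refine Finset.sum_congr rfl fun i _ => Finset.sum_congr rfl fun j _ => ?_
    rw [CStarMatrix.star_apply, ContinuousLinearMap.star_eq_adjoint,
      ContinuousLinearMap.adjoint_inner_right]
  rw [this, Complex.conj_re]

lemma matrixForm_star_mul_self_nonneg {n : ℕ} (S : CStarMatrix (Fin n) (Fin n) (H →L[ℂ] H))
    (ξ : Fin n → H) : 0 ≤ (matrixForm (star S * S) ξ ξ).re := by
  have : matrixForm (star S * S) ξ ξ = ∑ k, ⟪∑ i, S k i (ξ i), ∑ j, S k j (ξ j)⟫_ℂ := by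
    simp only [matrixForm, CStarMatrix.mul_apply, CStarMatrix.star_apply, sum_inner, inner_sum,
      sum_apply, mul_apply_eq_comp,
      ContinuousLinearMap.star_eq_adjoint, ContinuousLinearMap.adjoint_inner_right]
    exact Finset.sum_comm_cycle.trans (Finset.sum_congr rfl fun _ _ => Finset.sum_comm)
  rw [this, Complex.re_sum]
  exact Finset.sum_nonneg fun k _ => inner_self_nonneg (𝕜 := ℂ)

end MatrixForm

/-! ### Herglotz maps of a representation and a unitary -/

section HerglotzMap

universe u

variable {H : Type u} [NormedAddCommGroup H] [InnerProductSpace ℂ H] [CompleteSpace H]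
  {B : StarSubalgebra ℂ (H →L[ℂ] H)}
  {K : Type u} [NormedAddCommGroup K] [InnerProductSpace ℂ K] [CompleteSpace K]

/-- The operator matrix `(U ⊗ Iₙ) (α ⊗ 1ₙ)(X)` at which the Herglotz map applies the Cayley
transform. -/
noncomputable def herglotzArg (α : B →⋆ₐ[ℂ] (K →L[ℂ] K)) (U : K →L[ℂ] K) (X : FreeBall B) :
    CStarMatrix (Fin X.size) (Fin X.size) (K →L[ℂ] K) :=
  CStarMatrix.ofMatrix (Matrix.diagonal fun _ => U) * X.mat.map α

lemma herglotzMap_apply (V : H →ₗᵢ[ℂ] K) (α : B →⋆ₐ[ℂ] (K →L[ℂ] K)) (U : K →L[ℂ] K)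
    (X : FreeBall B) : herglotzMap V α U X =
      ((1 + herglotzArg α U X) * Ring.inverse (1 - herglotzArg α U X)).map (compression V) := rfl

lemma herglotzArg_apply (α : B →⋆ₐ[ℂ] (K →L[ℂ] K)) (U : K →L[ℂ] K) (X : FreeBall B)
    (i j : Fin X.size) : herglotzArg α U X i j = U * α (X.mat i j) :=
  Matrix.diagonal_mul _ _ _ _

/-- Matrix amplifications of `*`-homomorphisms of the `C*`-algebra `B` are contractive for the norm
that `Mₙ(B)` inherits from `Mₙ(B(H))`. -/
lemma norm_map_le_of_isClosed (hB : IsClosed (B : Set (H →L[ℂ] H))) (α : B →⋆ₐ[ℂ] (K →L[ℂ] K))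
    {n : ℕ} (X : CStarMatrix (Fin n) (Fin n) B) :
    ‖X.map α‖ ≤ ‖X.map (fun b : B => (b : H →L[ℂ] H))‖ := by
  have : IsClosed (B : Set (H →L[ℂ] H)) := hB
  let : PartialOrder B := CStarAlgebra.spectralOrder B
  have : StarOrderedRing B := CStarAlgebra.spectralOrderedRing B
  have h1 : ‖X.map α‖ ≤ ‖X‖ := NonUnitalStarAlgHom.norm_apply_le
    (CStarMatrix.mapₙₐ (n := Fin n) (α : B →⋆ₙₐ[ℂ] (K →L[ℂ] K))) X
  have h2 : ‖X.map (fun b : B => (b : H →L[ℂ] H))‖ = ‖X‖ := NonUnitalStarAlgHom.norm_map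
    (CStarMatrix.mapₙₐ (n := Fin n) (B.subtype : B →⋆ₙₐ[ℂ] (H →L[ℂ] H)))
    (CStarMatrix.map_injective Subtype.val_injective) X
  rwa [h2]

lemma diagonal_mem_unitary {U : K →L[ℂ] K} (hU : U ∈ unitary (K →L[ℂ] K)) (n : ℕ) :
    CStarMatrix.ofMatrix (Matrix.diagonal fun _ => U) ∈
      unitary (CStarMatrix (Fin n) (Fin n) (K →L[ℂ] K)) := by
  rw [Unitary.mem_iff] at hU ⊢
  constructor
  · refine (?_ : (Matrix.diagonal fun _ : Fin n => U).conjTranspose * Matrix.diagonal _ = 1)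
    rw [Matrix.diagonal_conjTranspose, Matrix.diagonal_mul_diagonal]
    simp [hU.1]
  · refine (?_ : Matrix.diagonal _ * (Matrix.diagonal fun _ : Fin n => U).conjTranspose = 1)
    rw [Matrix.diagonal_conjTranspose, Matrix.diagonal_mul_diagonal]
    simp [hU.2]

lemma norm_herglotzArg_le (hB : IsClosed (B : Set (H →L[ℂ] H))) (α : B →⋆ₐ[ℂ] (K →L[ℂ] K))
    {U : K →L[ℂ] K} (hU : U ∈ unitary (K →L[ℂ] K)) (X : FreeBall B) :
    ‖herglotzArg α U X‖ ≤ ‖X.mat.map (fun b : B => (b : H →L[ℂ] H))‖ := by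
  rw [herglotzArg, CStarRing.norm_mem_unitary_mul _ (diagonal_mem_unitary hU _)]
  exact norm_map_le_of_isClosed hB α X.mat

/-- With `F = (1 + T)(1 - T)⁻¹` and `W = (1 - T)⁻¹` one has `F + F* = 2 W* (1 - T* T) W`, which is
positive when `T` is a contraction. -/
lemma exists_cayley_add_star_eq {A : Type*} [CStarAlgebra A] {T : A} (hT : ‖T‖ < 1) :
    ∃ d : A, (1 + T) * Ring.inverse (1 - T) + star ((1 + T) * Ring.inverse (1 - T)) =
      star d * d + star d * d := by
  let : PartialOrder A := CStarAlgebra.spectralOrder A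
  have : StarOrderedRing A := CStarAlgebra.spectralOrderedRing A
  set W := Ring.inverse (1 - T) with hW
  have h1 : (1 - T) * W = 1 := Ring.mul_inverse_cancel _ (Units.oneSub T hT).isUnit
  have h2 : star W * (1 - star T) = 1 := by
    have := congrArg star h1
    simpa using this
  have hpos : 0 ≤ 1 - star T * T := by
    rw [sub_nonneg]
    refine CStarAlgebra.star_mul_le_algebraMap_norm_sq.trans ?_
    have := algebraMap_mono A (pow_le_one₀ (n := 2) (norm_nonneg T) hT.le)
    rwa [map_one] at this
  obtain ⟨c, hc⟩ := CStarAlgebra.nonneg_iff_eq_star_mul_self.mp hpos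
  refine ⟨c * W, ?_⟩
  calc (1 + T) * W + star ((1 + T) * W)
      = (star W * (1 - star T)) * ((1 + T) * W)
          + star W * (1 + star T) * ((1 - T) * W) := by
        rw [h1, h2]; simp
    _ = star W * (1 - star T * T) * W + star W * (1 - star T * T) * W := by noncomm_ring
    _ = _ := by rw [hc, star_mul]; noncomm_ring

lemma matrixForm_cayley_re_nonneg {n : ℕ} {T : CStarMatrix (Fin n) (Fin n) (K →L[ℂ] K)}
    (hT : ‖T‖ < 1) (ξ : Fin n → K) :
    0 ≤ (matrixForm ((1 + T) * Ring.inverse (1 - T)) ξ ξ).re := by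
  obtain ⟨d, hd⟩ := exists_cayley_add_star_eq hT
  have h := congrArg (fun S => (matrixForm S ξ ξ).re) hd
  simp only [matrixForm_add, Complex.add_re, matrixForm_star_self_re] at h
  have := matrixForm_star_mul_self_nonneg d ξ
  linarith

/-- Scalar matrices commute with entrywise linear maps of operator matrices. -/
lemma scalarMatrix_mul_map {R S : Type*} [Ring R] [Algebra ℂ R] [Ring S] [Algebra ℂ S]
    (f : R →ₗ[ℂ] S) {l m n : ℕ} (Γ : Matrix (Fin l) (Fin m) ℂ) (X : CStarMatrix (Fin m) (Fin n) R) :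
    scalarMatrix S Γ * X.map f = (scalarMatrix R Γ * X).map f := by
  ext i j
  simp [CStarMatrix.mul_apply, scalarMatrix, ← Algebra.smul_def]

lemma map_mul_scalarMatrix {R S : Type*} [Ring R] [Algebra ℂ R] [Ring S] [Algebra ℂ S]
    (f : R →ₗ[ℂ] S) {l m n : ℕ} (X : CStarMatrix (Fin l) (Fin m) R) (Γ : Matrix (Fin m) (Fin n) ℂ) :
    X.map f * scalarMatrix S Γ = (X * scalarMatrix R Γ).map f := by
  ext i j
  simp [CStarMatrix.mul_apply, scalarMatrix, ← Algebra.commutes, ← Algebra.smul_def]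

lemma scalarMatrix_mul_diagonal {R : Type*} [Ring R] [Algebra ℂ R] {m n : ℕ}
    (Γ : Matrix (Fin m) (Fin n) ℂ) (r : R) :
    scalarMatrix R Γ * CStarMatrix.ofMatrix (Matrix.diagonal fun _ : Fin n => r) =
      CStarMatrix.ofMatrix (Matrix.diagonal fun _ : Fin m => r) * scalarMatrix R Γ := by
  ext i j
  refine (Matrix.mul_diagonal _ _ _ _).trans ((Matrix.diagonal_mul _ _ _ _).trans ?_).symm
  exact (Algebra.commutes _ _).symm

lemma CStarMatrix.mul_assoc' {R : Type*} [Ring R] {k l m n : ℕ} (X : CStarMatrix (Fin k) (Fin l) R)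
    (Y : CStarMatrix (Fin l) (Fin m) R) (Z : CStarMatrix (Fin m) (Fin n) R) :
    X * Y * Z = X * (Y * Z) := Matrix.mul_assoc (α := R) X Y Z

/-- Cayley transforms inherit intertwining relations; `P` and `Q` play the roles of `(1 - S)⁻¹` and
`(1 - T)⁻¹`. -/
lemma Matrix.intertwines_cayley {R m n : Type*} [Ring R] [Fintype m] [Fintype n] [DecidableEq m]
    [DecidableEq n] {S P : Matrix m m R} {T Q : Matrix n n R} (hP : (1 - S) * P = 1)
    (hQ : Q * (1 - T) = 1) {Γ : Matrix n m R} (h : Γ * S = T * Γ) :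
    Γ * ((1 + S) * P) = ((1 + T) * Q) * Γ := by
  have h1 : Γ * (1 - S) = (1 - T) * Γ := by
    rw [Matrix.mul_sub, Matrix.sub_mul, h, Matrix.mul_one, Matrix.one_mul]
  have h2 : Γ * (1 + S) = (1 + T) * Γ := by
    rw [Matrix.mul_add, Matrix.add_mul, h, Matrix.mul_one, Matrix.one_mul]
  have h3 : Γ * P = Q * Γ := by
    calc Γ * P = Q * (1 - T) * Γ * P := by rw [hQ, Matrix.one_mul]
      _ = Q * Γ * ((1 - S) * P) := by
        rw [Matrix.mul_assoc Q, ← h1]; simp only [Matrix.mul_assoc]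
      _ = Q * Γ := by rw [hP, Matrix.mul_one]
  rw [← Matrix.mul_assoc, h2, Matrix.mul_assoc, h3, Matrix.mul_assoc]

lemma intertwines_cayley {m n : ℕ} {S : CStarMatrix (Fin m) (Fin m) (K →L[ℂ] K)}
    {T : CStarMatrix (Fin n) (Fin n) (K →L[ℂ] K)} (hS : ‖S‖ < 1) (hT : ‖T‖ < 1)
    {Γ : CStarMatrix (Fin n) (Fin m) (K →L[ℂ] K)} (h : Γ * S = T * Γ) :
    Γ * ((1 + S) * Ring.inverse (1 - S)) = ((1 + T) * Ring.inverse (1 - T)) * Γ :=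
  Matrix.intertwines_cayley (R := K →L[ℂ] K)
    (Ring.mul_inverse_cancel _ (Units.oneSub S hS).isUnit)
    (Ring.inverse_mul_cancel _ (Units.oneSub T hT).isUnit) h

theorem isRegularHerglotz_herglotzMap (hB : IsClosed (B : Set (H →L[ℂ] H))) (V : H →ₗᵢ[ℂ] K)
    (α : B →⋆ₐ[ℂ] (K →L[ℂ] K)) {U : K →L[ℂ] K} (hU : U ∈ unitary (K →L[ℂ] K)) :
    IsRegularHerglotz (herglotzMap V α U) where
  intertwines X Y Γ h := by
    have hα : scalarMatrix (K →L[ℂ] K) Γ * X.mat.map α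
        = Y.mat.map α * scalarMatrix (K →L[ℂ] K) Γ := by
      have h1 := scalarMatrix_mul_map (α : B →ₗ[ℂ] (K →L[ℂ] K)) Γ X.mat
      have h2 := map_mul_scalarMatrix (α : B →ₗ[ℂ] (K →L[ℂ] K)) Y.mat Γ
      rw [h, ← h2] at h1
      exact h1
    rw [herglotzMap_apply, herglotzMap_apply, scalarMatrix_mul_map, map_mul_scalarMatrix,
      intertwines_cayley ((norm_herglotzArg_le hB α hU X).trans_lt X.norm_lt_one)
        ((norm_herglotzArg_le hB α hU Y).trans_lt Y.norm_lt_one)]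
    rw [herglotzArg, herglotzArg, ← CStarMatrix.mul_assoc', scalarMatrix_mul_diagonal,
      CStarMatrix.mul_assoc', hα, CStarMatrix.mul_assoc']
  re_nonneg X ξ := by
    rw [herglotzMap_apply, matrixForm_map_compression]
    exact matrixForm_cayley_re_nonneg
      ((norm_herglotzArg_le hB α hU X).trans_lt X.norm_lt_one) _
  map_zero X hX := by
    have : herglotzArg α U X = 0 := by
      ext i j
      simp [herglotzArg_apply, hX]
    rw [herglotzMap_apply, this]
    ext i j : 1
    by_cases hij : i = j
    · subst hij; simp [compression_one]
    · simp [hij]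

lemma norm_herglotz_term_le {n : ℕ} (T : CStarMatrix (Fin n) (Fin n) (K →L[ℂ] K)) (k : ℕ) :
    ‖(1 + T) * T ^ k‖ ≤ (1 + ‖T‖) * ‖T‖ ^ k := by
  have h1 : ‖(1 : CStarMatrix (Fin n) (Fin n) (K →L[ℂ] K))‖ ≤ 1 := by
    have h := CStarRing.norm_star_mul_self (x := (1 : CStarMatrix (Fin n) (Fin n) (K →L[ℂ] K)))
    rw [star_one, mul_one] at h
    nlinarith [norm_nonneg (1 : CStarMatrix (Fin n) (Fin n) (K →L[ℂ] K))]
  have h2 : ‖T ^ k‖ ≤ ‖T‖ ^ k := by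
    induction k with
    | zero => simpa using h1
    | succ k ih =>
      rw [pow_succ, pow_succ]
      exact (norm_mul_le _ _).trans (by gcongr)
  calc ‖(1 + T) * T ^ k‖ ≤ ‖1 + T‖ * ‖T ^ k‖ := norm_mul_le _ _
    _ ≤ (1 + ‖T‖) * ‖T‖ ^ k := by
        gcongr
        exact (norm_add_le _ _).trans (by gcongr)

/-- The Neumann series of the Herglotz map. -/
lemma hasSum_matrixForm_herglotzMap (hB : IsClosed (B : Set (H →L[ℂ] H))) (V : H →ₗᵢ[ℂ] K)
    (α : B →⋆ₐ[ℂ] (K →L[ℂ] K)) {U : K →L[ℂ] K} (hU : U ∈ unitary (K →L[ℂ] K)) (X : FreeBall B)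
    (ξ η : Fin X.size → H) :
    HasSum (fun k : ℕ => matrixForm
        (((1 + herglotzArg α U X) * herglotzArg α U X ^ k).map (compression V)) ξ η)
      (matrixForm (herglotzMap V α U X) ξ η) := by
  set T := herglotzArg α U X with hTdef
  have hT : ‖T‖ < 1 := (norm_herglotzArg_le hB α hU X).trans_lt X.norm_lt_one
  have h1 : HasSum (fun k : ℕ => T ^ k) (Ring.inverse (1 - T)) := by
    rw [NormedRing.inverse_one_sub T hT]
    exact (summable_geometric_of_norm_lt_one hT).hasSum
  have h2 := (h1.mul_left (1 + T)).map (matrixFormₗ (V ∘ ξ) (V ∘ η)) (continuous_matrixForm _ _)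
  rw [herglotzMap_apply, matrixForm_map_compression]
  simp only [matrixForm_map_compression]
  exact h2

end HerglotzMap

/-! ### The universal norm and states coming from representations -/

section Representations

universe u

namespace AdjoinUnitary

lemma gen_of {B : Type*} [Ring B] [Algebra ℂ B] (b : B) : gen B (.of b) = ofAlgHom b := rfl

/-- Induction principle: `𝒜_B` is generated as a ring by `B`, `u` and `u*`. -/
lemma induction {B : Type*} [Ring B] [Algebra ℂ B] {p : AdjoinUnitary B → Prop}
    (of : ∀ b, p (ofAlgHom b)) (u : p (u B)) (uStar : p (gen B .uStar))
    (add : ∀ a b, p a → p b → p (a + b)) (mul : ∀ a b, p a → p b → p (a * b))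
    (a : AdjoinUnitary B) : p a := by
  obtain ⟨x, rfl⟩ := RingQuot.mkAlgHom_surjective ℂ (UnitaryRel B) a
  induction x using FreeAlgebra.induction with
  | grade0 r =>
    have := of (algebraMap ℂ B r)
    rw [AlgHom.commutes] at this
    rw [AlgHom.commutes]
    exact this
  | grade1 x =>
    cases x with
    | of b => exact of b
    | u => exact u
    | uStar => exact uStar
  | mul a b ha hb => rw [map_mul]; exact mul _ _ ha hb
  | add a b ha hb => rw [map_add]; exact add _ _ ha hb

/-- The `*`-homomorphism out of `𝒜_B` given by a `*`-homomorphism on `B` and a unitary. -/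
noncomputable def liftStar {B : Type*} [Ring B] [StarRing B] [Algebra ℂ B] [StarModule ℂ B]
    {R : Type*} [Ring R] [StarRing R] [Algebra ℂ R] (f : B →⋆ₐ[ℂ] R) (v : unitary R) :
    AdjoinUnitary B →⋆ₐ[ℂ] R where
  toAlgHom := lift f.toAlgHom v (star (v : R)) (Unitary.mul_star_self_of_mem v.2)
    (Unitary.star_mul_self_of_mem v.2)
  map_star' a := by
    change lift _ _ _ _ _ (star a) = star (lift _ _ _ _ _ a)
    induction a using AdjoinUnitary.induction with
    | of b =>
      rw [star_of, ← gen_of, ← gen_of, lift_gen, lift_gen]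
      exact map_star f b
    | u => rw [star_u, u, lift_gen, lift_gen]
    | uStar => rw [star_uStar, u, lift_gen, lift_gen, star_star]
    | add a b ha hb => simp only [star_add, map_add, ha, hb]
    | mul a b ha hb => simp only [star_mul, map_mul, ha, hb]

section LiftStar

variable {B : Type*} [Ring B] [StarRing B] [Algebra ℂ B] [StarModule ℂ B]
    {R : Type*} [Ring R] [StarRing R] [Algebra ℂ R] (f : B →⋆ₐ[ℂ] R) (v : unitary R)

lemma liftStar_of (b : B) : liftStar f v (ofAlgHom b) = f b :=
  lift_gen f.toAlgHom _ _ (Unitary.mul_star_self_of_mem v.2)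
    (Unitary.star_mul_self_of_mem v.2) (.of b)

lemma liftStar_u : liftStar f v (u B) = v :=
  lift_gen f.toAlgHom _ _ (Unitary.mul_star_self_of_mem v.2)
    (Unitary.star_mul_self_of_mem v.2) .u

lemma liftStar_uStar : liftStar f v (gen B .uStar) = star (v : R) :=
  lift_gen f.toAlgHom _ _ (Unitary.mul_star_self_of_mem v.2)
    (Unitary.star_mul_self_of_mem v.2) .uStar

end LiftStar

end AdjoinUnitary

lemma norm_le_one_of_mem_unitary {A : Type*} [CStarAlgebra A] {U : A} (hU : U ∈ unitary A) :
    ‖U‖ ≤ 1 := by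
  have h1 := CStarRing.norm_star_mul_self (x := (1 : A))
  have h2 := CStarRing.norm_star_mul_self (x := U)
  rw [star_one, mul_one] at h1
  rw [Unitary.star_mul_self_of_mem hU] at h2
  have h3 : ‖(1 : A)‖ ≤ 1 := by nlinarith [norm_nonneg (1 : A)]
  nlinarith [norm_nonneg U]

variable {H : Type u} [NormedAddCommGroup H] [InnerProductSpace ℂ H] [CompleteSpace H]
  {B : StarSubalgebra ℂ (H →L[ℂ] H)}

/-- The supremum defining the universal norm is finite. -/
lemma AdjoinUnitary.exists_norm_le (hB : IsClosed (B : Set (H →L[ℂ] H))) (a : AdjoinUnitary B) :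
    ∃ C : ℝ, ∀ (M : Type u) (_ : CStarAlgebra M) (π : AdjoinUnitary B →⋆ₐ[ℂ] M), ‖π a‖ ≤ C := by
  have : IsClosed (B : Set (H →L[ℂ] H)) := hB
  induction a using AdjoinUnitary.induction with
  | of b => exact ⟨‖b‖, fun M _ π => NonUnitalStarAlgHom.norm_apply_le (π.comp AdjoinUnitary.of) b⟩
  | u => exact ⟨1, fun M _ π => norm_le_one_of_mem_unitary (Unitary.map_mem π u_mem_unitary)⟩
  | uStar =>
    refine ⟨1, fun M _ π => norm_le_one_of_mem_unitary (Unitary.map_mem π ?_)⟩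
    rw [← star_u]
    exact Unitary.star_mem u_mem_unitary
  | add a b ha hb =>
    obtain ⟨C, hC⟩ := ha
    obtain ⟨D, hD⟩ := hb
    refine ⟨C + D, fun M _ π => ?_⟩
    rw [map_add]
    exact (norm_add_le _ _).trans (add_le_add (hC M _ π) (hD M _ π))
  | mul a b ha hb =>
    obtain ⟨C, hC⟩ := ha
    obtain ⟨D, hD⟩ := hb
    refine ⟨C * D, fun M _ π => ?_⟩
    rw [map_mul]
    exact (norm_mul_le _ _).trans (mul_le_mul (hC M _ π) (hD M _ π) (norm_nonneg _)
      ((norm_nonneg _).trans (hC M _ π)))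

lemma AdjoinUnitary.norm_le_universalNorm (hB : IsClosed (B : Set (H →L[ℂ] H)))
    {M : Type u} [CStarAlgebra M] (π : AdjoinUnitary B →⋆ₐ[ℂ] M) (a : AdjoinUnitary B) :
    ‖π a‖ ≤ a.universalNorm := by
  obtain ⟨C, hC⟩ := AdjoinUnitary.exists_norm_le hB a
  refine le_csSup ⟨C, ?_⟩ ⟨M, _, π, rfl⟩
  rintro _ ⟨N, _, ρ, rfl⟩
  exact hC N _ ρ

namespace OperatorValuedState

variable {K : Type u} [NormedAddCommGroup K] [InnerProductSpace ℂ K] [CompleteSpace K]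

/-- The map `a ↦ V* π(a) V` attached to a representation `π` of `𝒜_B` and an isometry `V`. -/
noncomputable def repMap (V : H →ₗᵢ[ℂ] K) (π : AdjoinUnitary B →⋆ₐ[ℂ] (K →L[ℂ] K)) :
    AdjoinUnitary B →ₗ[ℂ] (H →L[ℂ] H) where
  toFun a := compression V (π a)
  map_add' a b := by rw [map_add, map_add]
  map_smul' c a := by rw [map_smul, map_smul]; rfl

lemma inner_repMap_star_mul (V : H →ₗᵢ[ℂ] K) (π : AdjoinUnitary B →⋆ₐ[ℂ] (K →L[ℂ] K))
    (a b : AdjoinUnitary B) (h k : H) :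
    ⟪h, repMap V π (star a * b) k⟫_ℂ = ⟪π a (V h), π b (V k)⟫_ℂ := by
  change ⟪h, compression V (π (star a * b)) k⟫_ℂ = _
  rw [inner_compression, map_mul, map_star, mul_apply_eq_comp,
    ContinuousLinearMap.star_eq_adjoint, ContinuousLinearMap.adjoint_inner_right]

lemma sum_inner_repMap_star_mul (V : H →ₗᵢ[ℂ] K) (π : AdjoinUnitary B →⋆ₐ[ℂ] (K →L[ℂ] K))
    {n : ℕ} (a : Fin n → AdjoinUnitary B) (h : Fin n → H) :
    ∑ i, ∑ j, ⟪h j, repMap V π (star (a j) * a i) (h i)⟫_ℂ =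
      ((‖∑ i, π (a i) (V (h i))‖ ^ 2 : ℝ) : ℂ) := by
  simp only [inner_repMap_star_mul, ← sum_inner, ← inner_sum]
  rw [inner_self_eq_norm_sq_to_K]
  norm_cast

/-- The operator-valued state `a ↦ V* π(a) V` of a representation `π` of `𝒜_B`. -/
noncomputable def ofRep (hB : IsClosed (B : Set (H →L[ℂ] H))) (V : H →ₗᵢ[ℂ] K)
    (π : AdjoinUnitary B →⋆ₐ[ℂ] (K →L[ℂ] K)) : OperatorValuedState B H where
  toLinearMap := repMap V π
  unital := by
    change compression V (π 1) = 1
    rw [map_one, compression_one]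
  completely_positive n a h := by
    rw [sum_inner_repMap_star_mul, Complex.zero_le_real]
    positivity
  completely_bounded n a b h := by
    set N := (star b * b).universalNorm with hN
    have h1 : ∀ i j, ⟪h j, repMap V π (star (a j) *
        (algebraMap ℂ _ (N : ℂ) - star b * b) * a i) (h i)⟫_ℂ =
        (N : ℂ) * ⟪h j, repMap V π (star (a j) * a i) (h i)⟫_ℂ -
          ⟪h j, repMap V π (star (b * a j) * (b * a i)) (h i)⟫_ℂ := fun i j => by
      have e : star (a j) * (algebraMap ℂ _ (N : ℂ) - star b * b) * a i =
          (N : ℂ) • (star (a j) * a i) - star (b * a j) * (b * a i) := by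
        rw [Algebra.algebraMap_eq_smul_one, star_mul]
        simp only [mul_sub, sub_mul, mul_smul_comm, smul_mul_assoc, mul_one, mul_assoc]
      rw [e, map_sub, map_smul, sub_apply, inner_sub_right, smul_apply, inner_smul_right]
    have h2 : ‖π b‖ ^ 2 ≤ N := by
      have h3 := AdjoinUnitary.norm_le_universalNorm hB π (star b * b)
      rw [map_mul, map_star, CStarRing.norm_star_mul_self, ← sq] at h3
      exact h3
    simp only [h1, Finset.sum_sub_distrib, ← Finset.mul_sum]
    rw [sum_inner_repMap_star_mul, sum_inner_repMap_star_mul V π (fun i => b * a i),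
      ← Complex.ofReal_mul, ← Complex.ofReal_sub, Complex.zero_le_real, sub_nonneg]
    simp only [map_mul, mul_apply_eq_comp, ← map_sum]
    calc ‖π b (∑ i, π (a i) (V (h i)))‖ ^ 2 ≤ (‖π b‖ * ‖∑ i, π (a i) (V (h i))‖) ^ 2 := by
          gcongr; exact (π b).le_opNorm _
      _ = ‖π b‖ ^ 2 * ‖∑ i, π (a i) (V (h i))‖ ^ 2 := mul_pow _ _ _
      _ ≤ N * ‖∑ i, π (a i) (V (h i))‖ ^ 2 := by gcongr

/-! ### Moments of an operator-valued state -/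

lemma incl_apply (φ : OperatorValuedState B H) (h : H) :
    φ.incl h = ((φ.toPreGNS (1 ⊗ₜ h) : φ.PreGNS) : φ.GNS) := rfl

lemma rep_coe (φ : OperatorValuedState B H) (a : AdjoinUnitary B) (x : φ.PreGNS) :
    φ.rep a (x : φ.GNS) = (φ.leftMul a x : φ.PreGNS) :=
  ContinuousLinearMap.completion_apply_coe _ _

/-- The state is recovered from its GNS representation. -/
lemma compression_rep (φ : OperatorValuedState B H) (a : AdjoinUnitary B) :
    compression φ.incl (φ.rep a) = φ.toLinearMap a := by
  ext k
  refine ext_inner_left ℂ fun h => ?_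
  rw [inner_compression, incl_apply, incl_apply, rep_coe, leftMul_tmul,
    UniformSpace.Completion.inner_coe, preGNS_inner_def]
  simp

lemma norm_inner_apply_le (φ : OperatorValuedState B H) (a : AdjoinUnitary B) (h k : H) :
    ‖⟪h, φ.toLinearMap a k⟫_ℂ‖ ≤ √(star a * a).universalNorm * ‖h‖ * ‖k‖ := by
  rw [← compression_rep, inner_compression]
  have h1 : ‖φ.rep a (φ.incl k)‖ ≤ √(star a * a).universalNorm * ‖k‖ := by
    rw [← φ.incl.norm_map k, incl_apply, rep_coe, UniformSpace.Completion.norm_coe,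
      UniformSpace.Completion.norm_coe]
    exact φ.norm_leftMulₗ_le a _
  calc _ ≤ ‖φ.incl h‖ * ‖φ.rep a (φ.incl k)‖ := norm_inner_le_norm _ _
    _ ≤ ‖h‖ * (√(star a * a).universalNorm * ‖k‖) := by rw [φ.incl.norm_map]; gcongr
    _ = _ := by ring

lemma rep_u_mem_unitary (φ : OperatorValuedState B H) :
    φ.rep (AdjoinUnitary.u B) ∈ unitary (φ.GNS →L[ℂ] φ.GNS) :=
  Unitary.map_mem φ.rep AdjoinUnitary.u_mem_unitary

end OperatorValuedState

/-- The matrix `(u ⊗ Iₙ) X` over `𝒜_B`. -/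
noncomputable def FreeBall.uMul (X : FreeBall B) :
    Matrix (Fin X.size) (Fin X.size) (AdjoinUnitary B) :=
  Matrix.of fun i j => AdjoinUnitary.u B * AdjoinUnitary.of (X.mat i j)

section

variable {K : Type u} [NormedAddCommGroup K] [InnerProductSpace ℂ K] [CompleteSpace K]
  (π : AdjoinUnitary B →⋆ₐ[ℂ] (K →L[ℂ] K))

lemma herglotzArg_eq_mapMatrix (X : FreeBall B) :
    herglotzArg (π.comp AdjoinUnitary.of) (π (AdjoinUnitary.u B)) X =
      CStarMatrix.ofMatrix ((RingHomClass.toRingHom π).mapMatrix X.uMul) := by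
  refine CStarMatrix.ext fun i j => ?_
  rw [herglotzArg_apply]
  exact (map_mul π _ _).symm

lemma herglotzArg_term_apply (X : FreeBall B) (k : ℕ) (i j : Fin X.size) :
    ((1 + herglotzArg (π.comp AdjoinUnitary.of) (π (AdjoinUnitary.u B)) X) *
      herglotzArg (π.comp AdjoinUnitary.of) (π (AdjoinUnitary.u B)) X ^ k) i j =
        π (((1 + X.uMul) * X.uMul ^ k) i j) := by
  have h : CStarMatrix.ofMatrixRingEquiv
      ((RingHomClass.toRingHom π).mapMatrix ((1 + X.uMul) * X.uMul ^ k)) =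
      (1 + CStarMatrix.ofMatrixRingEquiv ((RingHomClass.toRingHom π).mapMatrix X.uMul)) *
        CStarMatrix.ofMatrixRingEquiv ((RingHomClass.toRingHom π).mapMatrix X.uMul) ^ k := by
    simp only [map_mul, map_add, map_one, map_pow]
  rw [herglotzArg_eq_mapMatrix]
  exact (congrFun (congrFun h i) j).symm

end

namespace OperatorValuedState

/-- The `k`-th term of the Neumann series of the Herglotz function: the form of the matrix over
`B(H)` obtained by applying `φ` to the entries of `(I + uX) (uX)ᵏ`. -/
noncomputable def herglotzTerm (φ : OperatorValuedState B H) (X : FreeBall B)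
    (ξ η : Fin X.size → H) (k : ℕ) : ℂ :=
  ∑ i, ∑ j, ⟪η i, φ.toLinearMap (((1 + X.uMul) * X.uMul ^ k) i j) (ξ j)⟫_ℂ

lemma matrixForm_herglotzArg_eq (φ : OperatorValuedState B H) (X : FreeBall B)
    (ξ η : Fin X.size → H) (k : ℕ) :
    matrixForm (((1 + herglotzArg (φ.rep.comp AdjoinUnitary.of) (φ.rep (AdjoinUnitary.u B)) X) *
      herglotzArg (φ.rep.comp AdjoinUnitary.of) (φ.rep (AdjoinUnitary.u B)) X ^ k).map
        (compression φ.incl)) ξ η = φ.herglotzTerm X ξ η k := by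
  unfold matrixForm herglotzTerm
  refine Finset.sum_congr rfl fun i _ => Finset.sum_congr rfl fun j _ => ?_
  rw [CStarMatrix.map_apply, herglotzArg_term_apply, compression_rep]

lemma hasSum_herglotzTerm (hB : IsClosed (B : Set (H →L[ℂ] H))) (φ : OperatorValuedState B H)
    (X : FreeBall B) (ξ η : Fin X.size → H) :
    HasSum (φ.herglotzTerm X ξ η) (matrixForm (φ.herglotz X) ξ η) := by
  have h := hasSum_matrixForm_herglotzMap hB φ.incl (φ.rep.comp AdjoinUnitary.of)
    φ.rep_u_mem_unitary X ξ η
  simp only [matrixForm_herglotzArg_eq] at h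
  exact h

lemma norm_herglotzTerm_le (hB : IsClosed (B : Set (H →L[ℂ] H))) (φ : OperatorValuedState B H)
    (X : FreeBall B) (ξ η : Fin X.size → H) (k : ℕ) :
    ‖φ.herglotzTerm X ξ η k‖ ≤ (∑ i, ∑ j, ‖η i‖ * ‖ξ j‖) *
      (2 * ‖X.mat.map (fun b : B => (b : H →L[ℂ] H))‖ ^ k) := by
  rw [← matrixForm_herglotzArg_eq, matrixForm_map_compression]
  have hT := norm_herglotzArg_le hB (φ.rep.comp AdjoinUnitary.of) φ.rep_u_mem_unitary X
  refine (norm_matrixForm_le _ _ _).trans ?_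
  simp only [Function.comp_apply, LinearIsometry.norm_map]
  gcongr
  refine (norm_herglotz_term_le _ k).trans ?_
  gcongr
  linarith [X.norm_lt_one]

end OperatorValuedState

end Representations

/-! ### Compactness of the set of conditional expectations -/

section Compactness

universe u

open Filter Topology

variable {H : Type u} [NormedAddCommGroup H] [InnerProductSpace ℂ H] [CompleteSpace H]
  {B : StarSubalgebra ℂ (H →L[ℂ] H)}

namespace OperatorValuedState

/-- The matrix coefficients `⟪h, φ(a) k⟫` of an operator-valued state. -/
noncomputable def coeff (φ : OperatorValuedState B H) (p : AdjoinUnitary B × H × H) : ℂ :=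
  ⟪p.2.1, φ.toLinearMap p.1 p.2.2⟫_ℂ

/-- The topology of pointwise convergence in the weak operator topology. -/
noncomputable instance pointwiseWOT : TopologicalSpace (OperatorValuedState B H) :=
  TopologicalSpace.induced coeff inferInstance

lemma continuous_inner_apply (a : AdjoinUnitary B) (h k : H) :
    Continuous fun φ : OperatorValuedState B H => ⟪h, φ.toLinearMap a k⟫_ℂ := by
  have h₁ : Continuous (coeff : OperatorValuedState B H → _) := continuous_induced_dom
  exact (continuous_apply (a, h, k)).comp h₁

lemma le_nhds_iff {l : Filter (OperatorValuedState B H)} {ψ : OperatorValuedState B H} :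
    l ≤ 𝓝 ψ ↔ ∀ a h k,
      Tendsto (fun φ => ⟪h, φ.toLinearMap a k⟫_ℂ) l (𝓝 ⟪h, ψ.toLinearMap a k⟫_ℂ) := by
  rw [nhds_induced, ← tendsto_iff_comap, tendsto_pi_nhds]
  exact ⟨fun H a h k => H (a, h, k), fun H p => H p.1 p.2.1 p.2.2⟩

/-- A bounded function on `H × H` that is conjugate linear in the first and linear in the second
variable is given by an operator. -/
lemma exists_clm_of_sesquilinear (F : H → H → ℂ) (C : ℝ)
    (add_left : ∀ h h' k, F (h + h') k = F h k + F h' k)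
    (smul_left : ∀ (c : ℂ) h k, F (c • h) k = starRingEnd ℂ c * F h k)
    (add_right : ∀ h k k', F h (k + k') = F h k + F h k')
    (smul_right : ∀ (c : ℂ) h k, F h (c • k) = c * F h k)
    (bound : ∀ h k, ‖F h k‖ ≤ C * ‖h‖ * ‖k‖) :
    ∃ T : H →L[ℂ] H, ∀ h k, ⟪h, T k⟫_ℂ = F h k := by
  let S : H →L⋆[ℂ] H →L[ℂ] ℂ := LinearMap.mkContinuous₂
    (LinearMap.mk₂'ₛₗ (starRingEnd ℂ) (RingHom.id ℂ) F add_left smul_left add_right smul_right)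
    C bound
  refine ⟨ContinuousLinearMap.adjoint (InnerProductSpace.continuousLinearMapOfBilin S),
    fun h k => ?_⟩
  rw [ContinuousLinearMap.adjoint_inner_right, InnerProductSpace.continuousLinearMapOfBilin_apply]
  rfl

/-- Operator-valued states are closed under ultralimits of their matrix coefficients, which exist
because the coefficients are uniformly bounded. -/
lemma exists_ultrafilter_le_nhds (𝒰 : Ultrafilter (OperatorValuedState B H)) :
    ∃ ψ : OperatorValuedState B H, (𝒰 : Filter _) ≤ 𝓝 ψ := by
  have hlim (a : AdjoinUnitary B) (h k : H) : ∃ z : ℂ,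
      Tendsto (fun φ : OperatorValuedState B H => ⟪h, φ.toLinearMap a k⟫_ℂ) 𝒰 (𝓝 z) := by
    obtain ⟨z, -, hz⟩ := (isCompact_closedBall (0 : ℂ)
      (√(star a * a).universalNorm * ‖h‖ * ‖k‖)).ultrafilter_le_nhds
        (𝒰.map fun φ : OperatorValuedState B H => ⟪h, φ.toLinearMap a k⟫_ℂ) (by
          rw [Ultrafilter.coe_map, le_principal_iff, mem_map]
          refine univ_mem' fun φ => ?_
          simpa using φ.norm_inner_apply_le a h k)
    exact ⟨z, hz⟩
  choose F hF using hlim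
  have hT (a : AdjoinUnitary B) : ∃ T : H →L[ℂ] H, ∀ h k, ⟪h, T k⟫_ℂ = F a h k := by
    refine exists_clm_of_sesquilinear (F a) (√(star a * a).universalNorm) ?_ ?_ ?_ ?_ ?_
    · exact fun h h' k => tendsto_nhds_unique (hF a (h + h') k)
        (((hF a h k).add (hF a h' k)).congr fun φ => (inner_add_left _ _ _).symm)
    · exact fun c h k => tendsto_nhds_unique (hF a (c • h) k)
        (((hF a h k).const_mul _).congr fun φ => (inner_smul_left _ _ _).symm)
    · exact fun h k k' => tendsto_nhds_unique (hF a h (k + k'))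
        (((hF a h k).add (hF a h k')).congr fun φ => by rw [map_add, inner_add_right])
    · exact fun c h k => tendsto_nhds_unique (hF a h (c • k))
        (((hF a h k).const_mul _).congr fun φ => by rw [map_smul, inner_smul_right])
    · exact fun h k => le_of_tendsto (hF a h k).norm
        (Eventually.of_forall fun φ => φ.norm_inner_apply_le a h k)
  choose T hT using hT
  have hlim (a : AdjoinUnitary B) (h k : H) :
      Tendsto (fun φ : OperatorValuedState B H => ⟪h, φ.toLinearMap a k⟫_ℂ) 𝒰
        (𝓝 ⟪h, T a k⟫_ℂ) := by
    rw [hT]; exact hF a h k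
  let ψ : OperatorValuedState B H :=
    { toLinearMap :=
        { toFun := T
          map_add' := fun a b => by
            ext k
            refine ext_inner_left ℂ fun h => tendsto_nhds_unique (hlim (a + b) h k) ?_
            rw [add_apply, inner_add_right]
            refine ((hlim a h k).add (hlim b h k)).congr fun φ => ?_
            rw [map_add, add_apply, inner_add_right]
          map_smul' := fun c a => by
            ext k
            refine ext_inner_left ℂ fun h => tendsto_nhds_unique (hlim (c • a) h k) ?_
            rw [RingHom.id_apply, smul_apply, inner_smul_right]
            refine ((hlim a h k).const_mul c).congr fun φ => ?_
            rw [map_smul, smul_apply, inner_smul_right] }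
      unital := by
        ext k
        refine ext_inner_left ℂ fun h => tendsto_nhds_unique (hlim 1 h k) ?_
        refine tendsto_const_nhds.congr fun φ => ?_
        rw [φ.unital]
      completely_positive := fun n a h => ge_of_tendsto
        (tendsto_finsetSum _ fun i _ => tendsto_finsetSum _ fun j _ => hlim _ (h j) (h i))
        (Eventually.of_forall fun φ => φ.completely_positive n a h)
      completely_bounded := fun n a b h => ge_of_tendsto
        (tendsto_finsetSum _ fun i _ => tendsto_finsetSum _ fun j _ => hlim _ (h j) (h i))
        (Eventually.of_forall fun φ => φ.completely_bounded n a b h) }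
  exact ⟨ψ, le_nhds_iff.mpr hlim⟩

lemma isClosed_conditionalExpectations
    (hB : IsClosed (ContinuousLinearMapWOT.ofCLM '' (B : Set (H →L[ℂ] H)) : Set (H →WOT[ℂ] H))) :
    IsClosed (conditionalExpectations B) := by
  refine IsClosed.inter (s₁ := {φ : OperatorValuedState B H | ∀ m, φ.toLinearMap m ∈ B})
    (s₂ := {φ : OperatorValuedState B H | ∀ (b₁ b₂ : B) (m : AdjoinUnitary B),
      φ.toLinearMap (AdjoinUnitary.of b₁ * m * AdjoinUnitary.of b₂) =
        (b₁ : H →L[ℂ] H) * φ.toLinearMap m * (b₂ : H →L[ℂ] H)}) ?_ ?_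
  · simp only [Set.ofPred_forall]
    refine isClosed_iInter fun m => ?_
    have hcont : Continuous fun φ : OperatorValuedState B H =>
        (ContinuousLinearMapWOT.ofCLM (φ.toLinearMap m) : H →WOT[ℂ] H) :=
      ContinuousLinearMapWOT.continuous_iff.mpr fun x y => continuous_inner_apply m y x
    convert hB.preimage hcont using 1
    ext φ
    exact (ContinuousLinearMapWOT.ofCLM_injective.mem_set_image
      (s := (B : Set (H →L[ℂ] H)))).symm
  · simp only [Set.ofPred_forall]
    refine isClosed_iInter fun b₁ => isClosed_iInter fun b₂ => isClosed_iInter fun m => ?_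
    have : {φ : OperatorValuedState B H |
        φ.toLinearMap (AdjoinUnitary.of b₁ * m * AdjoinUnitary.of b₂) =
          (b₁ : H →L[ℂ] H) * φ.toLinearMap m * (b₂ : H →L[ℂ] H)} =
        ⋂ (h : H) (k : H), {φ : OperatorValuedState B H |
          ⟪h, φ.toLinearMap (AdjoinUnitary.of b₁ * m * AdjoinUnitary.of b₂) k⟫_ℂ =
            ⟪ContinuousLinearMap.adjoint (b₁ : H →L[ℂ] H) h,
              φ.toLinearMap m ((b₂ : H →L[ℂ] H) k)⟫_ℂ} := by
      ext φ
      simp only [Set.mem_ofPred_eq, Set.mem_iInter, ContinuousLinearMap.adjoint_inner_left]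
      refine ⟨fun e h k => by rw [e]; rfl, fun e => ?_⟩
      ext k
      exact ext_inner_left ℂ fun h => e h k
    rw [this]
    exact isClosed_iInter fun h => isClosed_iInter fun k =>
      isClosed_eq (continuous_inner_apply _ _ _) (continuous_inner_apply _ _ _)

lemma isCompact_conditionalExpectations
    (hB : IsClosed (ContinuousLinearMapWOT.ofCLM '' (B : Set (H →L[ℂ] H)) : Set (H →WOT[ℂ] H))) :
    IsCompact (conditionalExpectations B) := by
  have : CompactSpace (OperatorValuedState B H) :=
    ⟨isCompact_iff_ultrafilter_le_nhds.mpr fun 𝒰 _ =>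
      (exists_ultrafilter_le_nhds 𝒰).imp fun _ h => ⟨Set.mem_univ _, h⟩⟩
  exact (isClosed_conditionalExpectations hB).isCompact

/-- The Neumann series of the Herglotz function converges uniformly in the state. -/
lemma continuous_herglotz (hB : IsClosed (B : Set (H →L[ℂ] H))) :
    Continuous (herglotz : OperatorValuedState B H → GradedMap B) := by
  refine continuous_iInf_rng.mpr fun X => continuous_iInf_rng.mpr fun ξ =>
    continuous_iInf_rng.mpr fun η => continuous_induced_rng.mpr ?_
  have : (fun g : GradedMap B => matrixForm (g X) ξ η) ∘ herglotz =
      fun φ : OperatorValuedState B H => ∑' k, φ.herglotzTerm X ξ η k :=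
    funext fun φ => (φ.hasSum_herglotzTerm hB X ξ η).tsum_eq.symm
  rw [this]
  refine continuous_tsum (fun k => ?_) ?_ fun k φ => φ.norm_herglotzTerm_le hB X ξ η k
  · exact continuous_finsetSum _ fun i _ => continuous_finsetSum _ fun j _ =>
      continuous_inner_apply _ _ _
  · exact ((summable_geometric_of_lt_one (norm_nonneg _) X.norm_lt_one).mul_left 2).mul_left _

end OperatorValuedState

instance GradedMap.t2Space : T2Space (GradedMap B) := by
  refine T2Space.of_injective_continuous
    (f := fun (g : GradedMap B) (p : Σ X : FreeBall B, (Fin X.size → H) × (Fin X.size → H)) =>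
      matrixForm (g p.1) p.2.1 p.2.2) (fun g g' h => ?_) (continuous_pi fun p => ?_)
  · exact funext fun X => eq_of_matrixForm_eq fun ξ η => congrFun h ⟨X, ξ, η⟩
  · exact continuous_iInf_dom (i := p.1) <| continuous_iInf_dom (i := p.2.1) <|
      continuous_iInf_dom (i := p.2.2) continuous_induced_dom

end Compactness

/-! ### A non-trivial endomorphism of `B` -/

section Endomorphism

/-- If the identity is the only unital `*`-endomorphism of a nonzero `C*`-algebra, then the algebra
is one-dimensional: inner automorphisms show that it is commutative, and then its characters,
regarded as endomorphisms, show that all its elements are scalars. -/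
lemma CStarAlgebra.exists_starAlgHom_ne_id {A : Type*} [CStarAlgebra A] [Nontrivial A]
    (hA : Module.rank ℂ A ≠ 1) : ∃ θ : A →⋆ₐ[ℂ] A, θ ≠ StarAlgHom.id ℂ A := by
  by_contra! hθ
  apply hA
  have hcomm (x y : A) : x * y = y * x := by
    have hx : x ∈ Submodule.span ℂ (unitary A : Set A) := by
      rw [CStarAlgebra.span_unitary]; trivial
    induction hx using Submodule.span_induction with
    | mem v hv =>
      have h := DFunLike.congr_fun
        (hθ (Unitary.conjStarAlgAut ℂ A ⟨v, hv⟩ : A →⋆ₐ[ℂ] A)) y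
      change v * y * star v = y at h
      calc v * y = v * y * (star v * v) := by rw [Unitary.star_mul_self_of_mem hv, mul_one]
        _ = y * v := by rw [← mul_assoc, h]
    | zero => rw [zero_mul, mul_zero]
    | add a b _ _ ha hb => rw [add_mul, mul_add, ha, hb]
    | smul c a _ ha => rw [smul_mul_assoc, mul_smul_comm, ha]
  let : CommCStarAlgebra A := { ‹CStarAlgebra A› with mul_comm := hcomm }
  obtain ⟨χ⟩ : Nonempty (WeakDual.characterSpace ℂ A) := inferInstance
  let χ' : A →⋆ₐ[ℂ] ℂ := (χ : A →⋆ₐ[ℂ] ℂ)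
  have h := DFunLike.congr_fun (hθ ((StarAlgHom.ofId ℂ A).comp χ'))
  refine rank_eq_one (1 : A) one_ne_zero fun a => ⟨χ' a, ?_⟩
  rw [← Algebra.algebraMap_eq_smul_one]
  exact h a

end Endomorphism

/-! ### Crossed-product type conditional expectations -/

section Shift

universe u

variable (H : Type u) [NormedAddCommGroup H]

/-- The Hilbert space `ℓ²(ℤ, H)`. -/
abbrev TwoSidedL2 : Type u := lp (fun _ : ℤ => H) 2

namespace TwoSidedL2

lemma memℓp_comp_add {f : ℤ → H} (hf : Memℓp f 2) (m : ℤ) : Memℓp (fun n => f (n + m)) 2 := by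
  rw [memℓp_gen_iff (by norm_num)] at hf ⊢
  exact (Equiv.addRight m).summable_iff.mpr hf

variable [InnerProductSpace ℂ H]

/-- Translation `(f n) ↦ (f (n + m))` on `ℓ²(ℤ, H)`. -/
noncomputable def translate (m : ℤ) : TwoSidedL2 H →ₗᵢ[ℂ] TwoSidedL2 H where
  toFun f := ⟨fun n => f (n + m), memℓp_comp_add H (lp.memℓp f) m⟩
  map_add' f g := rfl
  map_smul' c f := rfl
  norm_map' f := by
    rw [lp.norm_eq_tsum_rpow (by norm_num), lp.norm_eq_tsum_rpow (by norm_num)]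
    congr 1
    exact (Equiv.addRight m).tsum_eq fun n => ‖f n‖ ^ (2 : ENNReal).toReal

variable {H}

lemma translate_apply (m : ℤ) (f : TwoSidedL2 H) (n : ℤ) : translate H m f n = f (n + m) := rfl

variable (H) in
/-- The inclusion of `H` in degree `0`. -/
noncomputable def zeroIncl : H →ₗᵢ[ℂ] TwoSidedL2 H where
  toFun := lp.single (E := fun _ : ℤ => H) 2 0
  map_add' := lp.single_add (E := fun _ : ℤ => H) 2 0
  map_smul' := lp.single_smul (E := fun _ : ℤ => H) 2 0
  norm_map' h := lp.norm_single (E := fun _ : ℤ => H) (p := 2) (by norm_num) 0 h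

lemma zeroIncl_apply (h : H) (n : ℤ) : zeroIncl H h n = if n = 0 then h else 0 := by
  change lp.single (E := fun _ : ℤ => H) 2 (0 : ℤ) h n = _
  rw [lp.single_apply]
  rcases eq_or_ne n 0 with rfl | hn
  · simp
  · simp [hn]

lemma inner_zeroIncl (h : H) (f : TwoSidedL2 H) : ⟪zeroIncl H h, f⟫_ℂ = ⟪h, f 0⟫_ℂ :=
  lp.inner_single_left (G := fun _ : ℤ => H) 0 h f

variable [CompleteSpace H]

variable (H) in
/-- The bilateral shift, `(f n) ↦ (f (n - 1))`. -/
noncomputable def shift : unitary (TwoSidedL2 H →L[ℂ] TwoSidedL2 H) :=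
  Unitary.linearIsometryEquiv.symm
    { (translate H (-1)) with
      invFun := translate H 1
      left_inv := fun f => lp.ext <| funext fun n => by
        change f (n + 1 + -1) = f n
        rw [add_neg_cancel_right]
      right_inv := fun f => lp.ext <| funext fun n => by
        change f (n + -1 + 1) = f n
        rw [neg_add_cancel_right] }

lemma shift_apply (f : TwoSidedL2 H) (n : ℤ) :
    (shift H : TwoSidedL2 H →L[ℂ] TwoSidedL2 H) f n = f (n - 1) := rfl

lemma star_shift_apply (f : TwoSidedL2 H) (n : ℤ) :
    (star (shift H : TwoSidedL2 H →L[ℂ] TwoSidedL2 H)) f n = f (n + 1) := by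
  have h : (star (shift H : TwoSidedL2 H →L[ℂ] TwoSidedL2 H))
      ((shift H : TwoSidedL2 H →L[ℂ] TwoSidedL2 H) (translate H 1 f)) = translate H 1 f := by
    rw [← mul_apply_eq_comp, Unitary.star_mul_self_of_mem (shift H).2]
    rfl
  have h' : (shift H : TwoSidedL2 H →L[ℂ] TwoSidedL2 H) (translate H 1 f) = f :=
    lp.ext <| funext fun n => by rw [shift_apply, translate_apply, sub_add_cancel]
  rw [h'] at h
  rw [h, translate_apply]

lemma compression_zeroIncl_apply (S : TwoSidedL2 H →L[ℂ] TwoSidedL2 H) (k : H) :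
    compression (zeroIncl H) S k = S (zeroIncl H k) 0 :=
  ext_inner_left ℂ fun h => by rw [inner_compression, inner_zeroIncl]

end TwoSidedL2

open TwoSidedL2

variable {H} [InnerProductSpace ℂ H] [CompleteSpace H] {B : StarSubalgebra ℂ (H →L[ℂ] H)} (hB : IsClosed (B : Set (H →L[ℂ] H)))
  (θ : ℤ → (B →⋆ₐ[ℂ] B))

/-- The diagonal representation of `B` on `ℓ²(ℤ, H)`, through the endomorphism `θ n` in
degree `n`. -/
noncomputable def diagRep : B →⋆ₐ[ℂ] (TwoSidedL2 H →L[ℂ] TwoSidedL2 H) :=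
  have hb (b : B) (n : ℤ) : ‖(θ n b : H →L[ℂ] H)‖ ≤ ‖b‖ :=
    have : IsClosed (B : Set (H →L[ℂ] H)) := hB
    NonUnitalStarAlgHom.norm_apply_le (θ n) b
  { toFun b := lp.mapCLM 2 (fun n => (θ n b : H →L[ℂ] H)) (norm_nonneg b) (hb b)
    map_one' := by ext; simp
    map_mul' a b := by ext; simp
    map_zero' := by ext; simp
    map_add' a b := by ext; simp
    commutes' r := by
      ext f n
      simp [Algebra.algebraMap_eq_smul_one]
    map_star' b := by
      refine (ContinuousLinearMap.eq_adjoint_iff _ _).mpr fun f g => ?_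
      rw [lp.inner_eq_tsum, lp.inner_eq_tsum]
      refine tsum_congr fun n => ?_
      change ⟪(θ n (star b) : H →L[ℂ] H) (f n), g n⟫_ℂ = ⟪f n, (θ n b : H →L[ℂ] H) (g n)⟫_ℂ
      rw [map_star]
      exact ContinuousLinearMap.adjoint_inner_left _ _ _ }

lemma diagRep_apply (b : B) (f : TwoSidedL2 H) (n : ℤ) :
    diagRep hB θ b f n = (θ n b : H →L[ℂ] H) (f n) := rfl

/-- The representation of `𝒜_B` on `ℓ²(ℤ, H)` in which `B` acts diagonally and `u` is the bilateral
shift. -/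
noncomputable def shiftRep : AdjoinUnitary B →⋆ₐ[ℂ] (TwoSidedL2 H →L[ℂ] TwoSidedL2 H) :=
  AdjoinUnitary.liftStar (diagRep hB θ) (shift H)

lemma shiftRep_of (b : B) (f : TwoSidedL2 H) (n : ℤ) :
    shiftRep hB θ (AdjoinUnitary.ofAlgHom b) f n = (θ n b : H →L[ℂ] H) (f n) := by
  rw [shiftRep, AdjoinUnitary.liftStar_of, diagRep_apply]

lemma shiftRep_u (f : TwoSidedL2 H) (n : ℤ) :
    shiftRep hB θ (AdjoinUnitary.u B) f n = f (n - 1) := by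
  rw [shiftRep, AdjoinUnitary.liftStar_u, shift_apply]

lemma shiftRep_uStar (f : TwoSidedL2 H) (n : ℤ) :
    shiftRep hB θ (AdjoinUnitary.gen B .uStar) f n = f (n + 1) := by
  rw [shiftRep, AdjoinUnitary.liftStar_uStar, star_shift_apply]

/-- Applying an element of `𝒜_B` preserves the property that all components of a vector, depending
on `k ∈ H`, are given by elements of `B` applied to `k`. -/
lemma shiftRep_components_mem (a : AdjoinUnitary B) :
    ∀ f : H → TwoSidedL2 H, (∀ n, ∃ b : B, ∀ k, f k n = (b : H →L[ℂ] H) k) →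
      ∀ n, ∃ b : B, ∀ k, shiftRep hB θ a (f k) n = (b : H →L[ℂ] H) k := by
  induction a using AdjoinUnitary.induction with
  | of b =>
    intro f hf n
    obtain ⟨c, hc⟩ := hf n
    exact ⟨θ n b * c, fun k => by rw [shiftRep_of, hc]; rfl⟩
  | u => exact fun f hf n => (hf (n - 1)).imp fun b hb k => by rw [shiftRep_u, hb]
  | uStar => exact fun f hf n => (hf (n + 1)).imp fun b hb k => by rw [shiftRep_uStar, hb]
  | add a b ha hb =>
    intro f hf n
    obtain ⟨c, hc⟩ := ha f hf n
    obtain ⟨d, hd⟩ := hb f hf n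
    exact ⟨c + d, fun k => by
      rw [map_add, add_apply, lp.coeFn_add, Pi.add_apply, hc, hd]; rfl⟩
  | mul a b ha hb =>
    intro f hf n
    rw [map_mul]
    exact ha _ (hb f hf) n

/-- The compression of `shiftRep` to degree `0`, an operator-valued state on `𝒜_B`. It sends a word
in `B` and `u`, `u*` of nonzero total degree in `u` to zero, and otherwise to the product of the
letters from `B`, each twisted by the endomorphism of the degree at which it is read. -/
noncomputable def shiftState : OperatorValuedState B H :=
  OperatorValuedState.ofRep hB (zeroIncl H) (shiftRep hB θ)

lemma shiftState_apply (a : AdjoinUnitary B) (k : H) :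
    (shiftState hB θ).toLinearMap a k = shiftRep hB θ a (zeroIncl H k) 0 :=
  compression_zeroIncl_apply _ _

lemma shiftState_mem_conditionalExpectations (hθ : θ 0 = StarAlgHom.id ℂ B) :
    shiftState hB θ ∈ conditionalExpectations B := by
  refine ⟨fun a => ?_, fun b₁ b₂ a => ?_⟩
  · have h0 (n : ℤ) : ∃ b : B, ∀ k, zeroIncl H k n = (b : H →L[ℂ] H) k := by
      by_cases hn : n = 0
      · exact ⟨1, fun k => by simp [zeroIncl_apply, hn]⟩
      · exact ⟨0, fun k => by simp [zeroIncl_apply, hn]⟩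
    obtain ⟨b, hb⟩ := shiftRep_components_mem hB θ a (zeroIncl H) h0 0
    have : (shiftState hB θ).toLinearMap a = b := by
      ext k
      rw [shiftState_apply, hb]
    rw [this]
    exact b.2
  · have h (k : H) : shiftRep hB θ (AdjoinUnitary.ofAlgHom b₂) (zeroIncl H k) =
        zeroIncl H ((b₂ : H →L[ℂ] H) k) := lp.ext <| funext fun n => by
      rw [shiftRep_of, zeroIncl_apply, zeroIncl_apply]
      by_cases hn : n = 0
      · simp [hn, hθ]
      · simp [hn]
    ext k
    change (shiftState hB θ).toLinearMap
      (AdjoinUnitary.ofAlgHom b₁ * a * AdjoinUnitary.ofAlgHom b₂) k = _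
    rw [shiftState_apply, map_mul, map_mul, mul_apply_eq_comp, mul_apply_eq_comp, h,
      shiftRep_of, hθ, mul_apply_eq_comp, mul_apply_eq_comp, shiftState_apply]
    rfl

/-- The entries of `(uX)ᵏ` raise the degree by `k`. -/
lemma shiftRep_uMul_pow_apply (X : FreeBall B) (h : H) (k : ℕ) (i j : Fin X.size) (n : ℤ)
    (hn : n ≠ k) : shiftRep hB θ ((X.uMul ^ k) i j) (zeroIncl H h) n = 0 := by
  induction k generalizing i n with
  | zero =>
    rw [pow_zero, Matrix.one_apply]
    split_ifs
    · rw [map_one, one_apply_eq_self, zeroIncl_apply, if_neg (by simpa using hn)]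
    · rw [map_zero]; rfl
  | succ k ih =>
    rw [pow_succ', Matrix.mul_apply, map_sum, sum_apply, lp.coeFn_sum, Finset.sum_apply]
    refine Finset.sum_eq_zero fun l _ => ?_
    change shiftRep hB θ (AdjoinUnitary.u B * AdjoinUnitary.ofAlgHom (X.mat i l) * _)
      (zeroIncl H h) n = 0
    rw [map_mul, map_mul, mul_apply_eq_comp, mul_apply_eq_comp, shiftRep_u, shiftRep_of, ih l,
      map_zero]
    push_cast at hn
    omega

/-- All moments that enter the Herglotz function are independent of `θ`: only the word of length
zero contributes. -/
lemma shiftState_uMul_pow (X : FreeBall B) (k : ℕ) (i j : Fin X.size) :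
    (shiftState hB θ).toLinearMap ((X.uMul ^ k) i j) =
      if k = 0 then (1 : Matrix (Fin X.size) (Fin X.size) (H →L[ℂ] H)) i j else 0 := by
  split_ifs with hk
  · rw [hk, pow_zero, Matrix.one_apply, Matrix.one_apply]
    split_ifs
    · exact (shiftState hB θ).unital
    · exact map_zero _
  · ext h
    rw [shiftState_apply, shiftRep_uMul_pow_apply hB θ X h k i j 0 (by exact_mod_cast Ne.symm hk)]
    rfl

lemma shiftState_herglotz_eq (θ' : ℤ → (B →⋆ₐ[ℂ] B)) :
    (shiftState hB θ).herglotz = (shiftState hB θ').herglotz := by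
  refine funext fun X => eq_of_matrixForm_eq fun ξ η => ?_
  have h : (shiftState hB θ).herglotzTerm X ξ η = (shiftState hB θ').herglotzTerm X ξ η := by
    ext k
    refine Finset.sum_congr rfl fun i _ => Finset.sum_congr rfl fun j _ => ?_
    rw [add_mul, one_mul, ← pow_succ', Matrix.add_apply, map_add, map_add]
    simp only [shiftState_uMul_pow]
  rw [← ((shiftState hB θ).hasSum_herglotzTerm hB X ξ η).tsum_eq, h,
    ((shiftState hB θ').hasSum_herglotzTerm hB X ξ η).tsum_eq]

lemma shiftState_uStar_mul_of_mul_u (b : B) :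
    (shiftState hB θ).toLinearMap (AdjoinUnitary.gen B .uStar *
      (AdjoinUnitary.ofAlgHom b * AdjoinUnitary.u B)) = (θ 1 b : H →L[ℂ] H) := by
  ext k
  rw [shiftState_apply, map_mul, map_mul, mul_apply_eq_comp, mul_apply_eq_comp, shiftRep_uStar,
    shiftRep_of, shiftRep_u, zeroIncl_apply]
  simp

/-- With `θ n` equal to a non-trivial endomorphism for `n ≠ 0`, the state `shiftState` is separated
from the one with all `θ n` trivial by the mixed moments `u* b u`, which the Herglotz function does
not see. -/
lemma not_injOn_herglotz [Nontrivial H] (hdim : Module.rank ℂ B ≠ 1) :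
    ¬ Set.InjOn OperatorValuedState.herglotz (conditionalExpectations B) := by
  have : IsClosed (B : Set (H →L[ℂ] H)) := hB
  obtain ⟨θ, hθ⟩ := CStarAlgebra.exists_starAlgHom_ne_id hdim
  intro hinj
  let θ₁ : ℤ → (B →⋆ₐ[ℂ] B) := fun _ => StarAlgHom.id ℂ B
  let θ₂ : ℤ → (B →⋆ₐ[ℂ] B) := fun n => if n = 0 then StarAlgHom.id ℂ B else θ
  have h := hinj (shiftState_mem_conditionalExpectations hB θ₁ rfl)
    (shiftState_mem_conditionalExpectations hB θ₂ rfl) (shiftState_herglotz_eq hB θ₁ θ₂)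
  refine hθ (StarAlgHom.ext fun b => Subtype.ext ?_)
  have h₁ := shiftState_uStar_mul_of_mul_u hB θ₁ b
  have h₂ := shiftState_uStar_mul_of_mul_u hB θ₂ b
  rw [h, h₂] at h₁
  exact h₁

end Shift

/-! ### The Herglotz functions of conditional expectations -/

theorem mainTheorem3 {H : Type*} [NormedAddCommGroup H] [InnerProductSpace ℂ H] [CompleteSpace H]
    [Nontrivial H] (B : StarSubalgebra ℂ (H →L[ℂ] H)) (hB : IsClosed (B : Set (H →L[ℂ] H))) :
    Set.MapsTo OperatorValuedState.herglotz (conditionalExpectations B) (representableHerglotz B) ∧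
    (Module.rank ℂ B ≠ 1 →
      ¬ Set.InjOn OperatorValuedState.herglotz (conditionalExpectations B)) ∧
    (IsClosed (ContinuousLinearMapWOT.ofCLM '' (B : Set (H →L[ℂ] H)) : Set (H →WOT[ℂ] H)) →
      IsCompact (OperatorValuedState.herglotz '' conditionalExpectations B) ∧
      IsClosed (OperatorValuedState.herglotz '' conditionalExpectations B)) := by
  refine ⟨fun φ _ => ⟨isRegularHerglotz_herglotzMap hB _ _ φ.rep_u_mem_unitary, ?_⟩,
    not_injOn_herglotz hB, fun hWOT => ?_⟩
  · exact ⟨φ.GNS, inferInstance, inferInstance, inferInstance, φ.incl,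
      φ.rep.comp AdjoinUnitary.of, ⟨_, φ.rep_u_mem_unitary⟩, rfl⟩
  · have h := (OperatorValuedState.isCompact_conditionalExpectations hWOT).image
      (OperatorValuedState.continuous_herglotz hB)
    exact ⟨h, h.isClosed⟩
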